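/- **Conventions.** A matrix of real rational functions is *strictly proper* if in each entry the numerator has smaller degree than the denominator. For a nonsingular $R\in\mathbb R^{w\times w}[\xi]$ and $F\in\mathbb R^{\bullet\times w}[\xi]$, $F \bmod R$ is the unique polynomial matrix $F'$ such that $F'R^{-1}$ is strictly proper and $F-F'=NR$ with $N$ polynomial; for $\Phi(\zeta,\eta)=M(\zeta)^\top N(\eta)$, $\Phi\bmod R:=(M\bmod R)(\zeta)^\top (N\bmod R)(\eta)$ (this does not depend on the factorisation). $\ker R(\frac{d}{dt})$ is the set of smooth $v:\mathbb R\to\mathbb R^w$ with $R(\frac{d}{dt})v=0$; a *minimal state map* for it is a polynomial matrix whose rows form a basis over $\mathbb R$ of $\{f\in\mathbb R^{1\times w}[\xi] : fR^{-1}\text{ strictly proper}\}$. For $\Phi(\zeta,\eta)=\sum_{h,k}\Phi_{h,k}\zeta^h\eta^k$ put $Q_\Phi(v)=\sum_{h,k}(\frac{d^hv}{dt^h})^\top\Phi_{h,k}\frac{d^kv}{dt^k}$. A matrix $G\in\mathbb R^{w\times w}(\xi)$ is *strictly positive-real* if it is analytic in the open right half-plane, has no poles on the imaginary axis, and $G(-j\omega)^\top+G(j\omega)>0$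 for all $\omega\in\mathbb R$. **Standard SLDS.** Let $R_1,R_2\in\mathbb R^{w\times w}[\xi]$ be nonsingular with $R_2R_1^{-1}$ strictly proper, $n_i=\deg\det R_i$, $\mathfrak B_i=\ker R_i(\frac{d}{dt})$. Let $X_2\in\mathbb R^{n_2\times w}[\xi]$ be a minimal state map for $\mathfrak B_2$, let $X_1'\in\mathbb R^{(n_1-n_2)\times w}[\xi]$ be such that $\mathrm{col}(X_2,X_1')$ is a minimal state map for $\mathfrak B_1$, and let $\Pi$ be the real matrix with $X_1'\bmod R_2=\Pi X_2$. The trajectories of the standard SLDS $\Sigma$ for a switching signal $s:\mathbb R\to\{1,2\}$ (right-continuous, piecewise constant, with finitely many switching instants in every bounded interval) are the functions $v:\mathbb R\to\mathbb R^w$ that on each interval where $s$ is constantly $k$ coincide with an element of $\mathfrak B_k$, and that satisfy at each switching instant $t$ the gluing conditions: $X_2(\frac{d}{dt})v(t^-)=X_2(\frac{d}{dt})v(t^+)$ for a switch $1\to2$; $\mathrm{col}(X_2,\Pi X_2)(\frac{d}{dt})v(t^-)=\mathrm{col}(X_2,X_1')(\frac{d}{dt})v(t^+)$ for a switch $2\to1$.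 **Multiple Lyapunov function.** $\{\Psi_1,\Psi_2\}$ induces a multiple Lyapunov function for $\Sigma$ if for $i=1,2$: $Q_{\Psi_i}(v)\ge0$ for all $v\in\mathfrak B_i$; $\frac{d}{dt}Q_{\Psi_i}(v)\le0$ for all $v\in\mathfrak B_i$, and it vanishes identically only for $v=0$; and for every switching signal, every trajectory $v$ of $\Sigma$ for that signal, and every switching instant $t$ from mode $k$ to mode $\ell$, $Q_{\Psi_k}(v)(t^-)\ge Q_{\Psi_\ell}(v)(t^+)$. **Theorem.** Let $\Sigma$ be a standard SLDS and $\Psi_1\in\mathbb R^{w\times w}[\zeta,\eta]$. Suppose that $\{\Psi_1,\Psi_1\bmod R_2\}$ induces a multiple Lyapunov function for $\Sigma$, and that $(\zeta+\eta)\Psi_1(\zeta,\eta)\bmod R_1=-Q(\zeta)^\top Q(\eta)$ for some $Q\in\mathbb R^{\bullet\times w}[\xi]$ such that $\operatorname{rank}Q(j\omega)=w$ for all $\omega\in\mathbb R$ and $QR_1^{-1}$ is strictly proper. Then there exists $M\in\mathbb R^{w\times w}[\xi]$ such that $MR_2R_1^{-1}$ is strictly positive-real (i.e. $M$ is a strictly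 positive-real completion of $R_2R_1^{-1}$) and, moreover, strictly proper. -/

import Mathlib

open Polynomial Filter Topology
open scoped ContDiff ComplexOrder

namespace SwitchedLDS

/-! ### Rational and polynomial matrices -/

/-- A polynomial matrix regarded as a matrix of rational functions. -/
noncomputable def ratMat {r c : Type} (F : Matrix r c ℝ[X]) : Matrix r c (RatFunc ℝ) :=
  F.map (algebraMap ℝ[X] (RatFunc ℝ))

/-- A matrix of rational functions is strictly proper if in every entry the degree of the
numerator is smaller than that of the denominator (the zero entry being strictly proper). -/
def IsStrictlyProper {r c : Type} (G : Matrix r c (RatFunc ℝ)) : Prop :=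
  ∀ i j, (G i j).num.degree < (G i j).denom.degree

/-- The value at a complex number of a polynomial matrix. -/
noncomputable def evalC {r c : Type} (F : Matrix r c ℝ[X]) (z : ℂ) : Matrix r c ℂ :=
  F.map (Polynomial.aeval z)

/-- The value at a complex number of a matrix of rational functions. -/
noncomputable def ratEvalC {r c : Type} (G : Matrix r c (RatFunc ℝ)) (z : ℂ) : Matrix r c ℂ :=
  G.map (RatFunc.eval (algebraMap ℝ ℂ) z)

/-- Strict positive-realness: `G` is analytic in the open right half-plane, it is defined (has no
pole) on the imaginary axis, and `G(-jω)ᵀ + G(jω) > 0` for all real `ω`. -/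
structure IsStrictlyPositiveReal {w : ℕ} (G : Matrix (Fin w) (Fin w) (RatFunc ℝ)) : Prop where
  analytic : ∀ i j, AnalyticOnNhd ℂ (fun z => ratEvalC G z i j) {z : ℂ | 0 < z.re}
  no_pole_axis : ∀ i j, ∀ y : ℝ, Polynomial.aeval (Complex.I * (y : ℂ)) (G i j).denom ≠ 0
  pos : ∀ y : ℝ, ((ratEvalC G (-(Complex.I * (y : ℂ)))).transpose +
    ratEvalC G (Complex.I * (y : ℂ))).PosDef

/-- `F'` is the canonical representative of `F` modulo `R`, written `F mod R`:
`F R⁻¹ = S + N` with `N` polynomial, `S` strictly proper and `F' = S R`. For nonsingular `R`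
there is exactly one such `F'`. -/
def IsMod {r : Type} {w : ℕ} (R : Matrix (Fin w) (Fin w) ℝ[X]) (F F' : Matrix r (Fin w) ℝ[X]) :
    Prop :=
  IsStrictlyProper (ratMat F' * (ratMat R)⁻¹) ∧ ∃ N : Matrix r (Fin w) ℝ[X], F = F' + N * R

/-! ### Two-variable polynomial matrices; the variables `0`, `1` are `ζ`, `η` -/

/-- `F(ζ)`. -/
noncomputable def atZeta {r c : Type} (F : Matrix r c ℝ[X]) :
    Matrix r c (MvPolynomial (Fin 2) ℝ) :=
  F.map (Polynomial.aeval (MvPolynomial.X 0))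

/-- `F(η)`. -/
noncomputable def atEta {r c : Type} (F : Matrix r c ℝ[X]) :
    Matrix r c (MvPolynomial (Fin 2) ℝ) :=
  F.map (Polynomial.aeval (MvPolynomial.X 1))

/-- `(ζ + η) Ψ(ζ, η)`. -/
noncomputable def zetaAddEta {w : ℕ} (Ψ : Matrix (Fin w) (Fin w) (MvPolynomial (Fin 2) ℝ)) :
    Matrix (Fin w) (Fin w) (MvPolynomial (Fin 2) ℝ) :=
  (MvPolynomial.X 0 + MvPolynomial.X 1 : MvPolynomial (Fin 2) ℝ) • Ψ

/-- `Φ'` is the canonical representative `Φ mod R` of the two-variable polynomial matrix `Φ`: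
`Φ(ζ,η) = M(ζ)ᵀ N(η)` and `Φ'(ζ,η) = M'(ζ)ᵀ N'(η)` with `M' = M mod R`, `N' = N mod R`.
For nonsingular `R` there is exactly one such `Φ'`, whatever the factorisation of `Φ`. -/
def IsMod₂ {w : ℕ} (R : Matrix (Fin w) (Fin w) ℝ[X])
    (Φ Φ' : Matrix (Fin w) (Fin w) (MvPolynomial (Fin 2) ℝ)) : Prop :=
  ∃ (p : ℕ) (M N M' N' : Matrix (Fin p) (Fin w) ℝ[X]),
    Φ = (atZeta M).transpose * atEta N ∧ IsMod R M M' ∧ IsMod R N N' ∧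
      Φ' = (atZeta M').transpose * atEta N'

/-! ### Differential operators, behaviours, quadratic differential forms -/

/-- The vector `(G(d/dt) v)(t)`. -/
noncomputable def diffOp {r : Type} {w : ℕ} (G : Matrix r (Fin w) ℝ[X]) (v : ℝ → Fin w → ℝ)
    (t : ℝ) : r → ℝ :=
  fun i => ∑ j, (G i j).sum fun k c => c * iteratedDeriv k (fun τ => v τ j) t

/-- The behaviour `ker R(d/dt)`, consisting of smooth trajectories. -/
def kerD {r : Type} {w : ℕ} (R : Matrix r (Fin w) ℝ[X]) : Set (ℝ → Fin w → ℝ) :=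
  {v | ContDiff ℝ ∞ v ∧ ∀ t, diffOp R v t = 0}

/-- Linear time-invariant differential behaviours with `w` variables. -/
def IsLinearDifferentialBehaviour {w : ℕ} (B : Set (ℝ → Fin w → ℝ)) : Prop :=
  ∃ (g : ℕ) (R : Matrix (Fin g) (Fin w) ℝ[X]), B = kerD R

/-- The quadratic differential form `Q_Φ(v)(t)`: the sum over `h, k` of
`(dʰv/dtʰ)ᵀ Φ_{h,k} (dᵏv/dtᵏ)`, where `Φ_{h,k}` is the coefficient of `ζʰ ηᵏ`. -/
noncomputable def qdf {w : ℕ} (Φ : Matrix (Fin w) (Fin w) (MvPolynomial (Fin 2) ℝ))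
    (v : ℝ → Fin w → ℝ) (t : ℝ) : ℝ :=
  ∑ i, ∑ j, ∑ e ∈ (Φ i j).support, (Φ i j).coeff e *
    (iteratedDeriv (e 0) (fun τ => v τ i) t * iteratedDeriv (e 1) (fun τ => v τ j) t)

/-! ### Switched linear differential systems -/

/-- A switched linear differential system with `N` modes and `w` variables: a bank of behaviours
and, for a switch from mode `k` to mode `l ≠ k`, the pair of polynomial matrices
`(gMinus k l, gPlus k l)` with a common finite row index (the entries with `k = l` play no role). -/
structure SLDS (N w : ℕ) where
  behaviour : Fin N → Set (ℝ → Fin w → ℝ)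
  isLinear : ∀ k, IsLinearDifferentialBehaviour (behaviour k)
  rows : Fin N → Fin N → Type
  finite_rows : ∀ k l, Finite (rows k l)
  gMinus : ∀ k l, Matrix (rows k l) (Fin w) ℝ[X]
  gPlus : ∀ k l, Matrix (rows k l) (Fin w) ℝ[X]

/-- The switching instants of `s`: the times at which the left limit of `s` is not its value. -/
def switchTimes {N : ℕ} (s : ℝ → Fin N) : Set ℝ :=
  {t | ¬ ∀ᶠ τ in 𝓝[<] t, s τ = s t}

/-- Admissible switching signals: right-continuous, piecewise constant (with left limits), with
finitely many switching instants in every bounded interval. -/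
structure IsSwitchingSignal {N : ℕ} (s : ℝ → Fin N) : Prop where
  right_continuous : ∀ t, ∀ᶠ τ in 𝓝[>] t, s τ = s t
  left_limit : ∀ t, ∃ k, ∀ᶠ τ in 𝓝[<] t, s τ = k
  locally_finite : ∀ a b : ℝ, (switchTimes s ∩ Set.Icc a b).Finite

/-- The `s`-switched behaviour: on every interval on which `s` is constantly `k`, the trajectory
is the restriction of a trajectory of the `k`-th behaviour; at every switching instant, from
mode `k` to mode `s t`, the left limit of `G⁻(d/dt) v` equals the right limit of `G⁺(d/dt) v`. -/
def SLDS.switchedBehaviour {N w : ℕ} (S : SLDS N w) (s : ℝ → Fin N) : Set (ℝ → Fin w → ℝ) :=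
  {v | (∀ (k : Fin N) (J : Set ℝ), J.OrdConnected → (∀ t ∈ J, s t = k) →
          ∃ u ∈ S.behaviour k, Set.EqOn v u J) ∧
       ∀ t ∈ switchTimes s, ∀ k : Fin N, (∀ᶠ τ in 𝓝[<] t, s τ = k) →
          ∃ c : S.rows k (s t) → ℝ,
            Tendsto (diffOp (S.gMinus k (s t)) v) (𝓝[<] t) (𝓝 c) ∧
            Tendsto (diffOp (S.gPlus k (s t)) v) (𝓝[>] t) (𝓝 c)}

/-- The quadratic differential forms `Q_{Ψ k}` form a multiple Lyapunov function for `S`: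
each is nonnegative along its mode; its derivative is negative along that mode (it is nonpositive,
and vanishes identically only for the zero trajectory); and along every switched trajectory
the value does not increase at the switching instants. -/
structure SLDS.IsMLF {N w : ℕ} (S : SLDS N w)
    (Ψ : Fin N → Matrix (Fin w) (Fin w) (MvPolynomial (Fin 2) ℝ)) : Prop where
  nonneg : ∀ k, ∀ v ∈ S.behaviour k, ∀ t, 0 ≤ qdf (Ψ k) v t
  deriv_nonpos : ∀ k, ∀ v ∈ S.behaviour k, ∀ t, deriv (qdf (Ψ k) v) t ≤ 0
  deriv_definite : ∀ k, ∀ v ∈ S.behaviour k, (∀ t, deriv (qdf (Ψ k) v) t = 0) → v = 0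
  jump : ∀ s : ℝ → Fin N, IsSwitchingSignal s → ∀ v ∈ S.switchedBehaviour s,
    ∀ t ∈ switchTimes s, ∀ k : Fin N, (∀ᶠ τ in 𝓝[<] t, s τ = k) →
      ∀ a b : ℝ, Tendsto (qdf (Ψ k) v) (𝓝[<] t) (𝓝 a) →
        Tendsto (qdf (Ψ (s t)) v) (𝓝[>] t) (𝓝 b) → b ≤ a

/-! ### State maps and standard switched systems -/

/-- The state space of `ker R(d/dt)`: the polynomial row vectors `f` such that `f R⁻¹` is
strictly proper. -/
def stateSpace {w : ℕ} (R : Matrix (Fin w) (Fin w) ℝ[X]) : Set (Fin w → ℝ[X]) :=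
  {f | IsStrictlyProper (ratMat (Matrix.replicateRow Unit f) * (ratMat R)⁻¹)}

/-- `X(d/dt)` is a minimal state map for `ker R(d/dt)`: the rows of `X` are a basis over `ℝ` of
the state space of `ker R(d/dt)`. -/
structure IsMinimalStateMap {r : Type} {w : ℕ} (R : Matrix (Fin w) (Fin w) ℝ[X])
    (X : Matrix r (Fin w) ℝ[X]) : Prop where
  linearIndependent : LinearIndependent ℝ X.row
  span_eq : (Submodule.span ℝ (Set.range X.row) : Set (Fin w → ℝ[X])) = stateSpace R

/-- The data of a standard switched linear differential system with two modes `ker R₁(d/dt)` and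
`ker R₂(d/dt)`. Here `n₂ = deg det R₂`, `n₂ + d = deg det R₁`, `X₂` is a minimal state map for the
second mode, `col(X₂, X₁')` is one for the first mode, and `X₁' mod R₂ = P X₂`. -/
structure StandardSLDS (w : ℕ) where
  R₁ : Matrix (Fin w) (Fin w) ℝ[X]
  R₂ : Matrix (Fin w) (Fin w) ℝ[X]
  det_R₁ : R₁.det ≠ 0
  det_R₂ : R₂.det ≠ 0
  strictlyProper : IsStrictlyProper (ratMat R₂ * (ratMat R₁)⁻¹)
  n₂ : ℕ
  d : ℕ
  hn₂ : n₂ = R₂.det.natDegree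
  hn₁ : n₂ + d = R₁.det.natDegree
  X₂ : Matrix (Fin n₂) (Fin w) ℝ[X]
  X₁' : Matrix (Fin d) (Fin w) ℝ[X]
  P : Matrix (Fin d) (Fin n₂) ℝ
  minimal₂ : IsMinimalStateMap R₂ X₂
  minimal₁ : IsMinimalStateMap R₁ (Matrix.fromRows X₂ X₁')
  mod_eq : IsMod R₂ X₁' (P.map Polynomial.C * X₂)

/-- Row indices of the standard gluing conditions; modes `0`, `1` are the first and the second. -/
def standardRows (n₂ d : ℕ) : Fin 2 → Fin 2 → Type
  | 0, 0 => Fin n₂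
  | 0, 1 => Fin n₂
  | 1, 0 => Fin n₂ ⊕ Fin d
  | 1, 1 => Fin n₂

/-- The switched system of a standard SLDS. The gluing conditions are
`(G⁻, G⁺) = (X₂, X₂)` from the first to the second mode and
`(G⁻, G⁺) = (col(X₂, P X₂), col(X₂, X₁'))` from the second to the first mode. -/
noncomputable def StandardSLDS.toSLDS {w : ℕ} (S : StandardSLDS w) : SLDS 2 w where
  behaviour := ![kerD S.R₁, kerD S.R₂]
  isLinear := Fin.forall_fin_two.2 ⟨⟨w, S.R₁, rfl⟩, ⟨w, S.R₂, rfl⟩⟩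
  rows := standardRows S.n₂ S.d
  finite_rows := Fin.forall_fin_two.2
    ⟨Fin.forall_fin_two.2 ⟨inferInstanceAs (Finite (Fin S.n₂)), inferInstanceAs (Finite (Fin S.n₂))⟩,
      Fin.forall_fin_two.2
        ⟨inferInstanceAs (Finite (Fin S.n₂ ⊕ Fin S.d)), inferInstanceAs (Finite (Fin S.n₂))⟩⟩
  gMinus
    | 0, 0 => S.X₂
    | 0, 1 => S.X₂
    | 1, 0 => Matrix.fromRows S.X₂ (S.P.map Polynomial.C * S.X₂)
    | 1, 1 => S.X₂
  gPlus
    | 0, 0 => S.X₂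
    | 0, 1 => S.X₂
    | 1, 0 => Matrix.fromRows S.X₂ S.X₁'
    | 1, 1 => S.X₂

/-- `M` is a strictly positive-real completion of `R₂ R₁⁻¹`. -/
def IsSPRCompletion {w : ℕ} (R₁ R₂ M : Matrix (Fin w) (Fin w) ℝ[X]) : Prop :=
  IsStrictlyPositiveReal (ratMat M * ratMat R₂ * (ratMat R₁)⁻¹)

end SwitchedLDS

/-!
The completion is obtained from a state-space realisation of the first mode and the Lyapunov
equation carried by `Ψ₁`.

Let `X₁ = col(X₂, X₁')` be the state map of `ker R₁(d/dt)`. Since `X₁ R₁⁻¹` is strictly proper,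
`ξ X₁ = A X₁ + B R₁` with real matrices `A`, `B`, so `X₁ R₁⁻¹ = (ξ - A)⁻¹ B`
(`IsMinimalStateMap.exists_isRealization`, `IsRealization.ratMat_mul_inv_apply`). Along the mode,
the state satisfies `x' = A x`, every initial state occurs, and `Q_{Ψ₁}(v) = xᵀ P x` for a symmetric
real matrix `P`, which is positive semidefinite. Calculus modulo `R₁` turns the hypothesis on
`(ζ + η) Ψ₁` into `Aᵀ P + P A = -Lᵀ L` with `Q = L X₁` (`lyapunov_of_isMod₂`). As the derivative of
`Q_{Ψ₁}` vanishes identically only on the zero trajectory, `A` has no eigenvalue in the closed right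
half-plane (`aeval_charpoly_ne_zero_of_lyapunov`).

Consequently `G = Bᵀ P X₁ R₁⁻¹ = Bᵀ P (ξ - A)⁻¹ B` is strictly proper and analytic on the closed
right half-plane, and, with `H = (jω - A)⁻¹ B`, one has `G(-jω)ᵀ + G(jω) = (L H)* (L H)`. The
factorisation `Q(jω) = L H R₁(jω)` and the rank condition on `Q` make this positive definite
(`IsRealization.isStrictlyPositiveReal`).

It remains to see that `Bᵀ P X₁` is a left multiple `M R₂`. The rows of `B` belonging to `X₂` vanish
because `ξ X₂ R₁⁻¹ = (ξ X₂ R₂⁻¹) (R₂ R₁⁻¹)` is strictly proper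
(`StandardSLDS.input_inl_eq_zero`). The switching conditions in both directions force `xᵀ P x`, at
fixed `X₂`-part `u` of `x`, to be minimal at `(u, Π u)` (`StandardSLDS.storage_min`), so the lower
block row of `P` is `c · [-Π, I]`, where `c` is its lower right block. Hence
`Bᵀ P X₁ = B'ᵀ c (X₁' - Π X₂)`, with `B'` the lower block of `B`, and `X₁' - Π X₂` is a left
multiple of `R₂` because `X₁' mod R₂ = Π X₂` (`StandardSLDS.exists_mul_R₂_eq`).
-/

namespace SwitchedLDS

/-! ### Degrees of rational functions and strict properness -/

/-- The degree of `f` at infinity is at most `k`; the zero function satisfies this for every `k`.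
With `k = -1` this is strict properness, with `k = 0` properness. -/
def RatDegLE (k : ℤ) (f : RatFunc ℝ) : Prop := f = 0 ∨ f.intDegree ≤ k

theorem RatDegLE.zero (k : ℤ) : RatDegLE k 0 := Or.inl rfl

theorem RatDegLE.add {k : ℤ} {f g : RatFunc ℝ} (hf : RatDegLE k f) (hg : RatDegLE k g) :
    RatDegLE k (f + g) := by
  rcases hf with rfl | hf
  · simpa using hg
  rcases eq_or_ne g 0 with rfl | hg0
  · exact Or.inr (by simpa using hf)
  have hg' := hg.resolve_left hg0
  by_cases h : f + g = 0
  · exact Or.inl h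
  · exact Or.inr ((RatFunc.intDegree_add_le hg0 h).trans (max_le hf hg'))

theorem RatDegLE.neg {k : ℤ} {f : RatFunc ℝ} (hf : RatDegLE k f) : RatDegLE k (-f) := by
  rcases hf with rfl | hf
  · simpa using RatDegLE.zero k
  · exact Or.inr (by rwa [RatFunc.intDegree_neg])

theorem RatDegLE.sub {k : ℤ} {f g : RatFunc ℝ} (hf : RatDegLE k f) (hg : RatDegLE k g) :
    RatDegLE k (f - g) := sub_eq_add_neg f g ▸ hf.add hg.neg

theorem RatDegLE.mul {k l : ℤ} {f g : RatFunc ℝ} (hf : RatDegLE k f) (hg : RatDegLE l g) :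
    RatDegLE (k + l) (f * g) := by
  by_cases hf0 : f = 0
  · exact Or.inl (by simp [hf0])
  by_cases hg0 : g = 0
  · exact Or.inl (by simp [hg0])
  refine Or.inr ?_
  rw [RatFunc.intDegree_mul hf0 hg0]
  exact add_le_add (hf.resolve_left hf0) (hg.resolve_left hg0)

theorem RatDegLE.mono {k l : ℤ} (h : k ≤ l) {f : RatFunc ℝ} (hf : RatDegLE k f) :
    RatDegLE l f := hf.imp_right fun h' => h'.trans h

theorem RatDegLE.sum {ι : Type*} {k : ℤ} (s : Finset ι) (f : ι → RatFunc ℝ)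
    (h : ∀ i ∈ s, RatDegLE k (f i)) : RatDegLE k (∑ i ∈ s, f i) :=
  Finset.sum_induction f (RatDegLE k) (fun _ _ => RatDegLE.add) (RatDegLE.zero k) h

theorem ratDegLE_algebraMap (p : ℝ[X]) :
    RatDegLE p.natDegree (algebraMap ℝ[X] (RatFunc ℝ) p) :=
  Or.inr RatFunc.intDegree_polynomial.le

theorem ratDegLE_X : RatDegLE 1 (algebraMap ℝ[X] (RatFunc ℝ) X) := by
  simpa using ratDegLE_algebraMap X

theorem ratDegLE_C (a : ℝ) : RatDegLE 0 (algebraMap ℝ[X] (RatFunc ℝ) (C a)) := by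
  simpa using ratDegLE_algebraMap (C a)

theorem ratDegLE_neg_one_iff (f : RatFunc ℝ) :
    RatDegLE (-1) f ↔ f.num.degree < f.denom.degree := by
  by_cases hf : f = 0
  · subst hf
    simp [RatDegLE]
  · have h1 : f.num ≠ 0 := RatFunc.num_ne_zero hf
    rw [Polynomial.degree_eq_natDegree h1, Polynomial.degree_eq_natDegree f.denom_ne_zero]
    simp only [RatDegLE, hf, false_or, RatFunc.intDegree, Nat.cast_lt]
    omega

theorem isStrictlyProper_iff {r c : Type} (G : Matrix r c (RatFunc ℝ)) :
    IsStrictlyProper G ↔ ∀ i j, RatDegLE (-1) (G i j) := by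
  simp only [IsStrictlyProper, ratDegLE_neg_one_iff]

/-- A strictly proper polynomial vanishes. -/
theorem eq_zero_of_ratDegLE {p : ℝ[X]} (h : RatDegLE (-1) (algebraMap ℝ[X] (RatFunc ℝ) p)) :
    p = 0 := by
  rcases h with h | h
  · simpa using h
  · rw [RatFunc.intDegree_polynomial] at h
    omega

theorem eq_C_of_ratDegLE {p : ℝ[X]} (h : RatDegLE 0 (algebraMap ℝ[X] (RatFunc ℝ) p)) :
    p = C (p.coeff 0) := by
  rcases h with h | h
  · have : p = 0 := by simpa using h
    simp [this]
  · rw [RatFunc.intDegree_polynomial] at h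
    exact Polynomial.eq_C_of_natDegree_eq_zero (by omega)

theorem ratDegLE_div {p q : ℝ[X]} (h : p.degree < q.degree) :
    RatDegLE (-1) (algebraMap ℝ[X] (RatFunc ℝ) p / algebraMap ℝ[X] (RatFunc ℝ) q) := by
  by_cases hp : p = 0
  · exact Or.inl (by simp [hp])
  have hq : q ≠ 0 := by
    rintro rfl
    simp at h
  have hq' : algebraMap ℝ[X] (RatFunc ℝ) q ≠ 0 := by simpa using hq
  have hp' : algebraMap ℝ[X] (RatFunc ℝ) p ≠ 0 := by simpa using hp
  have h1 := RatFunc.intDegree_mul (div_ne_zero hp' hq') hq'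
  rw [div_mul_cancel₀ _ hq', RatFunc.intDegree_polynomial, RatFunc.intDegree_polynomial] at h1
  have h2 : p.natDegree < q.natDegree := Polynomial.natDegree_lt_natDegree hp h
  exact Or.inr (by omega)

/-- Every rational function is the sum of a polynomial and a strictly proper function. -/
theorem exists_ratDegLE_sub (f : RatFunc ℝ) :
    ∃ n : ℝ[X], RatDegLE (-1) (f - algebraMap ℝ[X] (RatFunc ℝ) n) := by
  refine ⟨f.num / f.denom, ?_⟩
  have hq : algebraMap ℝ[X] (RatFunc ℝ) f.denom ≠ 0 := by simpa using f.denom_ne_zero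
  have h : f - algebraMap ℝ[X] (RatFunc ℝ) (f.num / f.denom) =
      algebraMap ℝ[X] (RatFunc ℝ) (f.num % f.denom) / algebraMap ℝ[X] (RatFunc ℝ) f.denom := by
    rw [eq_div_iff hq, sub_mul]
    nth_rewrite 1 [← RatFunc.num_div_denom f]
    rw [div_mul_cancel₀ _ hq, sub_eq_iff_eq_add, ← map_mul, ← map_add, mul_comm,
      EuclideanDomain.mod_add_div]
  rw [h]
  exact ratDegLE_div (EuclideanDomain.mod_lt _ f.denom_ne_zero)

theorem num_div_mul (p : ℝ[X]) {q : ℝ[X]} (hq : q ≠ 0) :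
    (algebraMap ℝ[X] (RatFunc ℝ) p / algebraMap ℝ[X] (RatFunc ℝ) q).num * q =
      p * (algebraMap ℝ[X] (RatFunc ℝ) p / algebraMap ℝ[X] (RatFunc ℝ) q).denom := by
  set f := algebraMap ℝ[X] (RatFunc ℝ) p / algebraMap ℝ[X] (RatFunc ℝ) q with hf
  have hq' : algebraMap ℝ[X] (RatFunc ℝ) q ≠ 0 := by simpa using hq
  have hd : algebraMap ℝ[X] (RatFunc ℝ) f.denom ≠ 0 := by simpa using f.denom_ne_zero
  apply RatFunc.algebraMap_injective ℝ
  rw [map_mul, map_mul, ← div_eq_div_iff hd hq', RatFunc.num_div_denom, hf]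

/-- If `q z ≠ 0`, the reduced denominator of `p / q` does not vanish at `z` either. -/
theorem aeval_denom_div_ne_zero (p : ℝ[X]) {q : ℝ[X]} {z : ℂ} (hz : aeval z q ≠ 0) :
    aeval z (algebraMap ℝ[X] (RatFunc ℝ) p / algebraMap ℝ[X] (RatFunc ℝ) q).denom ≠ 0 := by
  obtain ⟨c, hc⟩ := RatFunc.denom_div_dvd p q
  intro h
  apply hz
  rw [hc, map_mul, h, zero_mul]

theorem eval_div_eq (p : ℝ[X]) {q : ℝ[X]} {z : ℂ} (hz : aeval z q ≠ 0) :
    RatFunc.eval (algebraMap ℝ ℂ) z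
      (algebraMap ℝ[X] (RatFunc ℝ) p / algebraMap ℝ[X] (RatFunc ℝ) q) =
      aeval z p / aeval z q := by
  have hq : q ≠ 0 := by
    rintro rfl
    simp at hz
  have h := congrArg (aeval z) (num_div_mul p hq)
  rw [map_mul, map_mul] at h
  exact (div_eq_div_iff (aeval_denom_div_ne_zero p hz) hz).2 h

/-! ### Polynomial matrices modulo a nonsingular matrix -/

theorem ratMat_mul {r c d : Type} [Fintype c] (F : Matrix r c ℝ[X]) (G : Matrix c d ℝ[X]) :
    ratMat (F * G) = ratMat F * ratMat G := Matrix.map_mul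

theorem ratMat_add {r c : Type} (F G : Matrix r c ℝ[X]) :
    ratMat (F + G) = ratMat F + ratMat G := Matrix.map_add _ (map_add _) F G

theorem ratMat_sub {r c : Type} (F G : Matrix r c ℝ[X]) :
    ratMat (F - G) = ratMat F - ratMat G := Matrix.map_sub _ (map_sub _) F G

section

variable {r n c : Type} [Fintype n] {w : ℕ} {R : Matrix (Fin w) (Fin w) ℝ[X]}

theorem isUnit_det_ratMat (hR : R.det ≠ 0) : IsUnit (ratMat R).det := by
  rw [isUnit_iff_ne_zero]
  have : (ratMat R).det = algebraMap ℝ[X] (RatFunc ℝ) R.det := by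
    rw [RingHom.map_det]
    rfl
  rw [this]
  simpa using hR

theorem ratMat_mul_mul_inv (hR : R.det ≠ 0) (F : Matrix r (Fin w) ℝ[X]) :
    ratMat (F * R) * (ratMat R)⁻¹ = ratMat F := by
  rw [ratMat_mul, Matrix.mul_nonsing_inv_cancel_right _ _ (isUnit_det_ratMat hR)]

theorem IsStrictlyProper.sub {G H : Matrix r c (RatFunc ℝ)} (hG : IsStrictlyProper G)
    (hH : IsStrictlyProper H) : IsStrictlyProper (G - H) := by
  rw [isStrictlyProper_iff] at *
  exact fun i j => (hG i j).sub (hH i j)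

theorem IsStrictlyProper.const_mul {G : Matrix n c (RatFunc ℝ)} (hG : IsStrictlyProper G)
    (a : Matrix r n ℝ) : IsStrictlyProper (ratMat (a.map C) * G) := by
  rw [isStrictlyProper_iff] at *
  intro i j
  rw [Matrix.mul_apply]
  refine RatDegLE.sum _ _ fun k _ => ?_
  have := (ratDegLE_C (a i k)).mul (hG k j)
  simpa [ratMat] using this

/-- If `N` is polynomial and `N R R⁻¹` is strictly proper then `N = 0`. -/
theorem eq_zero_of_isStrictlyProper (hR : R.det ≠ 0) {N : Matrix r (Fin w) ℝ[X]}
    (h : IsStrictlyProper (ratMat (N * R) * (ratMat R)⁻¹)) : N = 0 := by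
  rw [ratMat_mul_mul_inv hR, isStrictlyProper_iff] at h
  ext1 i j
  exact eq_zero_of_ratDegLE (h i j)

theorem exists_isStrictlyProper_sub (hR : R.det ≠ 0) (F : Matrix r (Fin w) ℝ[X]) :
    ∃ N : Matrix r (Fin w) ℝ[X], IsStrictlyProper (ratMat (F - N * R) * (ratMat R)⁻¹) := by
  choose N hN using fun i j => exists_ratDegLE_sub ((ratMat F * (ratMat R)⁻¹) i j)
  refine ⟨Matrix.of N, ?_⟩
  rw [ratMat_sub, Matrix.sub_mul, ratMat_mul_mul_inv hR, isStrictlyProper_iff]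
  exact hN

theorem mem_stateSpace_row {F : Matrix r (Fin w) ℝ[X]} :
    (∀ i, F.row i ∈ stateSpace R) ↔ IsStrictlyProper (ratMat F * (ratMat R)⁻¹) := by
  constructor
  · intro h i j
    exact h i () j
  · intro h i _ j
    exact h i j

variable {X : Matrix n (Fin w) ℝ[X]}

omit [Fintype n] in
theorem IsMinimalStateMap.isStrictlyProper (hX : IsMinimalStateMap R X) :
    IsStrictlyProper (ratMat X * (ratMat R)⁻¹) := by
  rw [← mem_stateSpace_row]
  intro i
  rw [← hX.span_eq]
  exact Submodule.subset_span ⟨i, rfl⟩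

theorem map_C_mul_row (a : Matrix r n ℝ) (X : Matrix n c ℝ[X]) (i : r) :
    (a.map C * X).row i = ∑ k, a i k • X.row k := by
  ext1 j
  simp [Matrix.mul_apply, Finset.sum_apply, Polynomial.smul_eq_C_mul]

/-- Elements of the state space are real combinations of the rows of a minimal state map. -/
theorem IsMinimalStateMap.exists_eq (hX : IsMinimalStateMap R X) {F : Matrix r (Fin w) ℝ[X]}
    (hF : IsStrictlyProper (ratMat F * (ratMat R)⁻¹)) :
    ∃ a : Matrix r n ℝ, F = a.map C * X := by
  rw [← mem_stateSpace_row, ← hX.span_eq] at hF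
  choose a ha using fun i => (Submodule.mem_span_range_iff_exists_fun ℝ).1 (hF i)
  refine ⟨Matrix.of a, ?_⟩
  ext1 i j
  have := congrFun (map_C_mul_row (Matrix.of a) X i) j
  rw [Matrix.row_apply] at this
  rw [this]
  exact (congrFun (ha i) j).symm

/-- Uniqueness of state coefficients modulo `R`. -/
theorem IsMinimalStateMap.coeff_unique (hR : R.det ≠ 0) (hX : IsMinimalStateMap R X)
    {a b : Matrix r n ℝ} {N : Matrix r (Fin w) ℝ[X]}
    (h : a.map C * X = b.map C * X + N * R) : a = b := by
  have hsp : IsStrictlyProper (ratMat (N * R) * (ratMat R)⁻¹) := by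
    rw [← sub_eq_iff_eq_add'] at h
    rw [← h, ratMat_sub, Matrix.sub_mul, ratMat_mul, ratMat_mul, Matrix.mul_assoc,
      Matrix.mul_assoc]
    exact (hX.isStrictlyProper.const_mul a).sub (hX.isStrictlyProper.const_mul b)
  rw [eq_zero_of_isStrictlyProper hR hsp, Matrix.zero_mul, add_zero] at h
  ext i k
  have hi : ∑ k, a i k • X.row k = ∑ k, b i k • X.row k := by
    rw [← map_C_mul_row, ← map_C_mul_row, h]
  rw [← sub_eq_zero, ← Finset.sum_sub_distrib] at hi
  simp only [← sub_smul] at hi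
  exact sub_eq_zero.1 (Fintype.linearIndependent_iff.1 hX.linearIndependent _ hi k)

end

/-! ### State-space realisations -/

/-- `(A, B, K)` realises `ker R(d/dt)` in the coordinates of the state map `X`: modulo the left
multiples of `R`, multiplication by the indeterminate acts on the rows of `X` as `A` (with constant
quotient `B`), and the identity matrix is `K X`. Hence along `ker R(d/dt)` the state
`x = X(d/dt)v` satisfies `x' = A x` and `v = K x`. -/
structure IsRealization {n : Type} [Fintype n] {w : ℕ} (R : Matrix (Fin w) (Fin w) ℝ[X])
    (X : Matrix n (Fin w) ℝ[X]) (A : Matrix n n ℝ) (B : Matrix n (Fin w) ℝ)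
    (K : Matrix (Fin w) n ℝ) : Prop where
  shift : (Polynomial.X : ℝ[X]) • X = A.map C * X + B.map C * R
  output : ∃ D : Matrix (Fin w) (Fin w) ℝ[X], 1 = K.map C * X + D * R

/-- The coefficients, in the coordinates of the state, of the rows of `F` modulo `R`: row `i` is
`∑ⱼ Kⱼ Fᵢⱼ(A)`. -/
noncomputable def stateCoeff {r n : Type} [Fintype n] [DecidableEq n] {w : ℕ} (A : Matrix n n ℝ)
    (K : Matrix (Fin w) n ℝ) (F : Matrix r (Fin w) ℝ[X]) : Matrix r n ℝ :=
  Matrix.of fun i => ∑ j, Matrix.vecMul (K j) (aeval A (F i j))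

section

variable {r n : Type} [Fintype n] {w : ℕ} {R : Matrix (Fin w) (Fin w) ℝ[X]}
  {X : Matrix n (Fin w) ℝ[X]} {A : Matrix n n ℝ} {B : Matrix n (Fin w) ℝ}
  {K : Matrix (Fin w) n ℝ}

theorem IsMinimalStateMap.exists_isRealization (hR : R.det ≠ 0) (hX : IsMinimalStateMap R X) :
    ∃ A B K, IsRealization R X A B K := by
  obtain ⟨N, hN⟩ := exists_isStrictlyProper_sub hR ((Polynomial.X : ℝ[X]) • X)
  obtain ⟨A, hA⟩ := hX.exists_eq hN
  obtain ⟨D, hD⟩ := exists_isStrictlyProper_sub hR (1 : Matrix (Fin w) (Fin w) ℝ[X])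
  obtain ⟨K, hK⟩ := hX.exists_eq hD
  -- `X R⁻¹` is strictly proper, so the polynomial part of `ξ X R⁻¹` is constant
  have hN0 : N = (N.map fun p => p.coeff 0).map C := by
    ext1 i j
    refine eq_C_of_ratDegLE ?_
    rw [ratMat_sub, Matrix.sub_mul, ratMat_mul_mul_inv hR] at hN
    have h1 := (isStrictlyProper_iff _).1 hN i j
    have h2 := ratDegLE_X.mul ((isStrictlyProper_iff _).1 hX.isStrictlyProper i j)
    have h3 : (ratMat ((Polynomial.X : ℝ[X]) • X) * (ratMat R)⁻¹) i j =
        algebraMap ℝ[X] (RatFunc ℝ) Polynomial.X * (ratMat X * (ratMat R)⁻¹) i j := by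
      simp [ratMat, Matrix.mul_apply, Finset.mul_sum, mul_assoc]
    rw [Matrix.sub_apply, h3] at h1
    have h4 := (h2.mono (by norm_num : (1 + -1 : ℤ) ≤ 0)).sub (h1.mono (by norm_num))
    rwa [sub_sub_cancel] at h4
  refine ⟨A, N.map fun p => p.coeff 0, K, ?_, D, ?_⟩
  · rw [← hN0, ← hA, sub_add_cancel]
  · rw [← hK, sub_add_cancel]

theorem map_C_comp_vecMul {m : Type} [Fintype m] (u : n → ℝ) (a : Matrix n m ℝ) :
    (fun k => C (Matrix.vecMul u a k)) = Matrix.vecMul (fun k => C (u k)) (a.map C) := by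
  ext1 k
  simp [Matrix.vecMul, dotProduct, map_sum]

variable [DecidableEq n]

theorem IsRealization.exists_smul_eq (h : IsRealization R X A B K) (p : ℝ[X]) :
    ∃ N : Matrix n (Fin w) ℝ[X], p • X = (aeval A p).map C * X + N * R := by
  induction p using Polynomial.induction_on' with
  | add p q hp hq =>
    obtain ⟨M, hM⟩ := hp
    obtain ⟨N, hN⟩ := hq
    refine ⟨M + N, ?_⟩
    rw [add_smul, hM, hN, map_add, Matrix.map_add _ (map_add _), Matrix.add_mul, Matrix.add_mul]
    abel
  | monomial k c =>
    induction k with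
    | zero =>
      refine ⟨0, ?_⟩
      ext1 i j
      simp [Matrix.algebraMap_eq_diagonal, Matrix.mul_apply, Matrix.diagonal_apply]
    | succ k ih =>
      obtain ⟨N, hN⟩ := ih
      refine ⟨(aeval A (monomial k c)).map C * B.map C + (Polynomial.X : ℝ[X]) • N, ?_⟩
      have h1 : monomial (k + 1) c = Polynomial.X * monomial k c := by
        rw [Polynomial.X_mul_monomial]
      have h2 : aeval A (monomial (k + 1) c) = aeval A (monomial k c) * A := by
        rw [h1, mul_comm, map_mul, aeval_X]
      rw [h2, h1, mul_smul, hN, smul_add, ← Matrix.mul_smul, h.shift, Matrix.map_mul,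
        Matrix.mul_add, Matrix.add_mul, Matrix.mul_assoc, Matrix.mul_assoc, Matrix.smul_mul,
        add_assoc]

theorem IsRealization.exists_eq (h : IsRealization R X A B K) (F : Matrix r (Fin w) ℝ[X]) :
    ∃ N : Matrix r (Fin w) ℝ[X], F = (stateCoeff A K F).map C * X + N * R := by
  choose N hN using h.exists_smul_eq
  obtain ⟨D, hD⟩ := h.output
  refine ⟨Matrix.of fun i => ∑ j, (Matrix.vecMul (fun k => C (K j k)) (N (F i j)) +
    F i j • D j), ?_⟩
  have key : ∀ (p : ℝ[X]) (j : Fin w), p • (1 : Matrix (Fin w) (Fin w) ℝ[X]) j =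
      Matrix.vecMul (fun k => C (Matrix.vecMul (K j) (aeval A p) k)) X +
        Matrix.vecMul (Matrix.vecMul (fun k => C (K j k)) (N p) + p • D j) R := by
    intro p j
    have h1 : (1 : Matrix (Fin w) (Fin w) ℝ[X]) j =
        Matrix.vecMul (fun k => C (K j k)) X + Matrix.vecMul (D j) R := congrFun hD j
    rw [h1, smul_add, ← Matrix.vecMul_smul, hN p, map_C_comp_vecMul, Matrix.vecMul_add,
      Matrix.add_vecMul, Matrix.vecMul_vecMul, Matrix.vecMul_vecMul, Matrix.smul_vecMul, add_assoc]
  funext i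
  have h2 : F i = ∑ j, F i j • (1 : Matrix (Fin w) (Fin w) ℝ[X]) j := by
    ext1 l
    simp [Finset.sum_apply, Matrix.one_apply]
  have h3 : ((stateCoeff A K F).map C * X) i =
      ∑ j, Matrix.vecMul (fun k => C (Matrix.vecMul (K j) (aeval A (F i j)) k)) X := by
    rw [← Matrix.sum_vecMul]
    change Matrix.vecMul (fun k => C (stateCoeff A K F i k)) X = _
    congr 1
    ext1 k
    simp [stateCoeff, Finset.sum_apply]
  rw [h2]
  simp only [key]
  rw [Finset.sum_add_distrib, ← Matrix.sum_vecMul Finset.univ _ R]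
  change _ = ((stateCoeff A K F).map C * X) i + _
  rw [h3]
  rfl

theorem stateCoeff_eq_of_eq_add (hR : R.det ≠ 0) (hX : IsMinimalStateMap R X)
    (h : IsRealization R X A B K) {F G N : Matrix r (Fin w) ℝ[X]} (hFG : F = G + N * R) :
    stateCoeff A K F = stateCoeff A K G := by
  obtain ⟨N₁, h₁⟩ := h.exists_eq F
  obtain ⟨N₂, h₂⟩ := h.exists_eq G
  refine hX.coeff_unique hR (N := N₂ + N - N₁) ?_
  rw [Matrix.sub_mul, Matrix.add_mul, eq_sub_of_add_eq h₁.symm, hFG, eq_sub_of_add_eq h₂.symm]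
  abel

theorem stateCoeff_const_mul (hR : R.det ≠ 0) (hX : IsMinimalStateMap R X)
    (h : IsRealization R X A B K) (a : Matrix r n ℝ) :
    stateCoeff A K (a.map C * X) = a := by
  obtain ⟨N, hN⟩ := h.exists_eq (a.map C * X)
  exact (hX.coeff_unique hR hN).symm

theorem stateCoeff_stateMap (hR : R.det ≠ 0) (hX : IsMinimalStateMap R X)
    (h : IsRealization R X A B K) : stateCoeff A K X = 1 := by
  have := stateCoeff_const_mul hR hX h (1 : Matrix n n ℝ)
  rwa [Matrix.map_one _ C_0 C_1, Matrix.one_mul] at this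

theorem stateCoeff_self (hR : R.det ≠ 0) (hX : IsMinimalStateMap R X)
    (h : IsRealization R X A B K) : stateCoeff A K R = 0 := by
  obtain ⟨N, hN⟩ := h.exists_eq R
  refine hX.coeff_unique hR (N := 1 - N) ?_
  rw [Matrix.sub_mul, eq_sub_of_add_eq hN.symm]
  simp

/-! ### Trajectories generated by the state equation -/

/-- `x` solves `x' = A x`. -/
def IsStateTrajectory (A : Matrix n n ℝ) (x : ℝ → n → ℝ) : Prop :=
  ∀ t, HasDerivAt x (A.mulVec (x t)) t

omit [DecidableEq n] in
theorem exists_isStateTrajectory (A : Matrix n n ℝ) (x₀ : n → ℝ) :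
    ∃ x, IsStateTrajectory A x ∧ x 0 = x₀ := by
  let L : (n → ℝ) →L[ℝ] (n → ℝ) := LinearMap.toContinuousLinearMap (Matrix.mulVecLin A)
  refine ⟨fun t => NormedSpace.exp (t • L) x₀, fun t => ?_, by simp⟩
  have h := (hasDerivAt_exp_smul_const' L t).clm_apply (hasDerivAt_const t x₀)
  simpa [L] using h

omit [DecidableEq n] in
theorem IsStateTrajectory.hasDerivAt_dotProduct {x : ℝ → n → ℝ} (hx : IsStateTrajectory A x)
    (u : n → ℝ) (t : ℝ) :
    HasDerivAt (fun τ => dotProduct u (x τ)) (dotProduct u (A.mulVec (x t))) t :=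
  HasDerivAt.fun_sum fun i _ => ((hasDerivAt_pi.1 (hx t)) i).const_mul (u i)

theorem IsStateTrajectory.iteratedDeriv_dotProduct {x : ℝ → n → ℝ} (hx : IsStateTrajectory A x)
    (u : n → ℝ) (k : ℕ) :
    iteratedDeriv k (fun τ => dotProduct u (x τ)) =
      fun τ => dotProduct (Matrix.vecMul u (A ^ k)) (x τ) := by
  induction k generalizing u with
  | zero => simp
  | succ k ih =>
    rw [iteratedDeriv_succ', funext fun t => (hx.hasDerivAt_dotProduct u t).deriv]
    simp only [Matrix.dotProduct_mulVec]
    rw [ih, pow_succ', Matrix.vecMul_vecMul]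

theorem IsStateTrajectory.contDiff {x : ℝ → n → ℝ} (hx : IsStateTrajectory A x) :
    ContDiff ℝ ∞ fun t => K.mulVec (x t) := by
  rw [contDiff_pi]
  intro j
  refine contDiff_of_differentiable_iteratedDeriv fun m _ => ?_
  change Differentiable ℝ (iteratedDeriv m fun τ => dotProduct (K j) (x τ))
  rw [hx.iteratedDeriv_dotProduct]
  exact fun t => (hx.hasDerivAt_dotProduct _ t).differentiableAt

/-- On `v = K x` with `x' = A x`, the operator `F(d/dt)` acts through its state coefficients. -/
theorem IsStateTrajectory.diffOp_eq {x : ℝ → n → ℝ} (hx : IsStateTrajectory A x)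
    (F : Matrix r (Fin w) ℝ[X]) (t : ℝ) :
    diffOp F (fun τ => K.mulVec (x τ)) t = (stateCoeff A K F).mulVec (x t) := by
  ext i
  change _ = dotProduct (∑ j, Matrix.vecMul (K j) (aeval A (F i j))) (x t)
  rw [sum_dotProduct]
  refine Finset.sum_congr rfl fun j _ => ?_
  have h1 : (fun τ => K.mulVec (x τ) j) = fun τ => dotProduct (K j) (x τ) := rfl
  simp only [h1, hx.iteratedDeriv_dotProduct]
  rw [aeval_eq_sum_range, Polynomial.sum_over_range _ (by simp), Matrix.vecMul_sum,
    sum_dotProduct]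
  simp [Matrix.vecMul_smul, smul_dotProduct]

theorem IsStateTrajectory.mem_kerD (hR : R.det ≠ 0) (hX : IsMinimalStateMap R X)
    (h : IsRealization R X A B K) {x : ℝ → n → ℝ} (hx : IsStateTrajectory A x) :
    (fun t => K.mulVec (x t)) ∈ kerD R :=
  ⟨hx.contDiff, fun t => by rw [hx.diffOp_eq, stateCoeff_self hR hX h, Matrix.zero_mulVec]⟩

end

/-! ### Quadratic differential forms as quadratic forms in the state -/

section

variable {r n : Type} [Fintype n] {w : ℕ} {R : Matrix (Fin w) (Fin w) ℝ[X]}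
  {X : Matrix n (Fin w) ℝ[X]} {A : Matrix n n ℝ} {B : Matrix n (Fin w) ℝ}
  {K : Matrix (Fin w) n ℝ} [DecidableEq n]

/-- The linear map `ζʰ ηᵏ ↦ (Aʰ)ᵀ T Aᵏ`. -/
noncomputable def twoVarEval (A T : Matrix n n ℝ) : MvPolynomial (Fin 2) ℝ →ₗ[ℝ] Matrix n n ℝ :=
  (MvPolynomial.basisMonomials (Fin 2) ℝ).constr ℝ fun e =>
    (A ^ e 0).transpose * T * A ^ e 1

theorem twoVarEval_monomial (A T : Matrix n n ℝ) (e : Fin 2 →₀ ℕ) (c : ℝ) :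
    twoVarEval A T (MvPolynomial.monomial e c) = c • ((A ^ e 0).transpose * T * A ^ e 1) := by
  have h : MvPolynomial.monomial e c = c • MvPolynomial.basisMonomials (Fin 2) ℝ e := by
    rw [MvPolynomial.coe_basisMonomials, MvPolynomial.smul_monomial, smul_eq_mul, mul_one]
  rw [h, map_smul, twoVarEval, Module.Basis.constr_basis]

theorem twoVarEval_eq_sum (A T : Matrix n n ℝ) (p : MvPolynomial (Fin 2) ℝ) :
    twoVarEval A T p =
      ∑ e ∈ p.support, p.coeff e • ((A ^ e 0).transpose * T * A ^ e 1) := by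
  conv_lhs => rw [← MvPolynomial.support_sum_monomial_coeff p]
  rw [map_sum]
  simp only [twoVarEval_monomial]

theorem twoVarEval_X_mul (A T : Matrix n n ℝ) (p : MvPolynomial (Fin 2) ℝ) :
    twoVarEval A T ((MvPolynomial.X 0 + MvPolynomial.X 1) * p) =
      A.transpose * twoVarEval A T p + twoVarEval A T p * A := by
  induction p using MvPolynomial.induction_on' with
  | add p q hp hq =>
    rw [mul_add, map_add, hp, hq, map_add, Matrix.mul_add, Matrix.add_mul]
    abel
  | monomial e c =>
    rw [add_mul, MvPolynomial.X, MvPolynomial.X, MvPolynomial.monomial_mul,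
      MvPolynomial.monomial_mul, map_add, twoVarEval_monomial, twoVarEval_monomial,
      twoVarEval_monomial, one_mul, Matrix.mul_smul, Matrix.smul_mul]
    simp only [Finsupp.add_apply, Finsupp.single_apply]
    norm_num
    rw [add_comm 1 (e 0), add_comm 1 (e 1), pow_succ', pow_succ A]
    simp only [Matrix.mul_assoc]

theorem twoVarEval_aeval_mul_aeval (A T : Matrix n n ℝ) (p q : ℝ[X]) :
    twoVarEval A T (aeval (MvPolynomial.X 0) p * aeval (MvPolynomial.X 1) q) =
      (aeval A p).transpose * T * aeval A q := by
  induction p using Polynomial.induction_on' with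
  | add p p' hp hp' =>
    rw [map_add, add_mul, map_add, hp, hp', map_add, Matrix.transpose_add, Matrix.add_mul,
      Matrix.add_mul]
  | monomial k c =>
    induction q using Polynomial.induction_on' with
    | add q q' hq hq' =>
      rw [map_add, mul_add, map_add, hq, hq', map_add, Matrix.mul_add]
    | monomial l d =>
      have h : aeval (MvPolynomial.X 0) (monomial k c) * aeval (MvPolynomial.X 1) (monomial l d) =
          MvPolynomial.monomial (Finsupp.single (0 : Fin 2) k + Finsupp.single 1 l) (c * d) := by
        rw [aeval_monomial, aeval_monomial, MvPolynomial.algebraMap_eq,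
          MvPolynomial.X_pow_eq_monomial, MvPolynomial.X_pow_eq_monomial,
          MvPolynomial.C_mul_monomial, MvPolynomial.C_mul_monomial,
          MvPolynomial.monomial_mul, mul_one, mul_one]
      rw [h, twoVarEval_monomial, aeval_monomial, aeval_monomial, ← Algebra.smul_def,
        ← Algebra.smul_def, Matrix.transpose_smul, Matrix.smul_mul, Matrix.smul_mul,
        Matrix.mul_smul, smul_smul]
      simp

/-- The matrix of the quadratic form in the state which represents `Q_Φ` along `v = K x`,
`x' = A x`; it need not be symmetric. -/
noncomputable def stateForm (A : Matrix n n ℝ) (K : Matrix (Fin w) n ℝ)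
    (Φ : Matrix (Fin w) (Fin w) (MvPolynomial (Fin 2) ℝ)) : Matrix n n ℝ :=
  ∑ i, ∑ j, twoVarEval A (Matrix.vecMulVec (K i) (K j)) (Φ i j)

theorem stateForm_zetaAddEta (Φ : Matrix (Fin w) (Fin w) (MvPolynomial (Fin 2) ℝ)) :
    stateForm A K (zetaAddEta Φ) =
      A.transpose * stateForm A K Φ + stateForm A K Φ * A := by
  simp only [stateForm, zetaAddEta, Matrix.smul_apply, smul_eq_mul, twoVarEval_X_mul,
    Finset.sum_add_distrib, Matrix.mul_sum, Matrix.sum_mul]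

theorem stateForm_neg (Φ : Matrix (Fin w) (Fin w) (MvPolynomial (Fin 2) ℝ)) :
    stateForm A K (-Φ) = -stateForm A K Φ := by
  simp [stateForm]

theorem stateForm_mul [Fintype r] (M N : Matrix r (Fin w) ℝ[X]) :
    stateForm A K ((atZeta M).transpose * atEta N) =
      (stateCoeff A K M).transpose * stateCoeff A K N := by
  have h1 : (stateCoeff A K M).transpose * stateCoeff A K N =
      ∑ p, Matrix.vecMulVec (stateCoeff A K M p) (stateCoeff A K N p) := by
    ext k l
    simp [Matrix.mul_apply, Matrix.sum_apply, Matrix.vecMulVec_apply]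
  have h2 : ∀ (T S : Matrix n n ℝ) (u v : n → ℝ),
      T.transpose * Matrix.vecMulVec u v * S =
        Matrix.vecMulVec (Matrix.vecMul u T) (Matrix.vecMul v S) := by
    intro T S u v
    rw [Matrix.mul_vecMulVec, Matrix.vecMulVec_mul, Matrix.mulVec_transpose]
  have h3 : ∀ p, Matrix.vecMulVec (stateCoeff A K M p) (stateCoeff A K N p) =
      ∑ i, ∑ j, Matrix.vecMulVec (Matrix.vecMul (K i) (aeval A (M p i)))
        (Matrix.vecMul (K j) (aeval A (N p j))) := by
    intro p
    ext k l
    simp [stateCoeff, Matrix.sum_apply, Matrix.vecMulVec_apply, Finset.sum_apply,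
      Finset.sum_mul_sum]
  simp only [h1, h3, stateForm, Matrix.mul_apply, atZeta, atEta, Matrix.transpose_apply,
    Matrix.map_apply, map_sum, twoVarEval_aeval_mul_aeval, h2]
  rw [Finset.sum_comm (s := (Finset.univ : Finset r))]
  exact Finset.sum_congr rfl fun i _ => Finset.sum_comm.symm

theorem IsStateTrajectory.qdf_eq {x : ℝ → n → ℝ} (hx : IsStateTrajectory A x)
    (Φ : Matrix (Fin w) (Fin w) (MvPolynomial (Fin 2) ℝ)) (t : ℝ) :
    qdf Φ (fun τ => K.mulVec (x τ)) t =
      dotProduct (x t) ((stateForm A K Φ).mulVec (x t)) := by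
  have h : ∀ i, (fun τ => K.mulVec (x τ) i) = fun τ => dotProduct (K i) (x τ) := fun _ => rfl
  simp only [qdf, stateForm, h, hx.iteratedDeriv_dotProduct, twoVarEval_eq_sum, Matrix.sum_mulVec,
    dotProduct_sum, Matrix.smul_mulVec, dotProduct_smul, smul_eq_mul]
  refine Finset.sum_congr rfl fun i _ => Finset.sum_congr rfl fun j _ =>
    Finset.sum_congr rfl fun e _ => ?_
  rw [Matrix.mul_vecMulVec, Matrix.vecMulVec_mul, Matrix.mulVec_transpose,
    Matrix.vecMulVec_mulVec]
  simp only [dotProduct_smul, MulOpposite.smul_eq_mul_unop, MulOpposite.unop_op]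
  rw [dotProduct_comm (x t)]

end

/-! ### Trajectories with a single switch -/

section

variable {w : ℕ}

theorem continuous_diffOp {r : Type} (G : Matrix r (Fin w) ℝ[X]) {v : ℝ → Fin w → ℝ}
    (hv : ContDiff ℝ ∞ v) : Continuous (diffOp G v) := by
  refine continuous_pi fun i => continuous_finsetSum _ fun j _ =>
    continuous_finsetSum _ fun k _ => continuous_const.mul ?_
  exact (contDiff_pi.1 hv j).continuous_iteratedDeriv k (by exact_mod_cast le_top)

theorem continuous_qdf (Φ : Matrix (Fin w) (Fin w) (MvPolynomial (Fin 2) ℝ))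
    {v : ℝ → Fin w → ℝ} (hv : ContDiff ℝ ∞ v) : Continuous (qdf Φ v) := by
  have h : ∀ (j : Fin w) (k : ℕ), Continuous (iteratedDeriv k fun τ => v τ j) := fun j k =>
    (contDiff_pi.1 hv j).continuous_iteratedDeriv k (by exact_mod_cast le_top)
  exact continuous_finsetSum _ fun i _ => continuous_finsetSum _ fun j _ =>
    continuous_finsetSum _ fun e _ => continuous_const.mul ((h i _).mul (h j _))

theorem diffOp_congr {r : Type} (G : Matrix r (Fin w) ℝ[X]) {u v : ℝ → Fin w → ℝ} {t : ℝ}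
    (h : u =ᶠ[𝓝 t] v) : diffOp G u t = diffOp G v t := by
  have h' : ∀ j k, iteratedDeriv k (fun τ => u τ j) t = iteratedDeriv k (fun τ => v τ j) t :=
    fun j k => EventuallyEq.iteratedDeriv_eq k (h.mono fun τ hτ => congrFun hτ j)
  ext i
  simp only [diffOp, h']

theorem qdf_congr (Φ : Matrix (Fin w) (Fin w) (MvPolynomial (Fin 2) ℝ)) {u v : ℝ → Fin w → ℝ}
    {t : ℝ} (h : u =ᶠ[𝓝 t] v) : qdf Φ u t = qdf Φ v t := by
  have h' : ∀ j k, iteratedDeriv k (fun τ => u τ j) t = iteratedDeriv k (fun τ => v τ j) t :=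
    fun j k => EventuallyEq.iteratedDeriv_eq k (h.mono fun τ hτ => congrFun hτ j)
  simp only [qdf, h']

/-- The function equal to `a` before time `0` and to `b` from time `0` on. -/
noncomputable def switchAtZero {α : Type} (a b : ℝ → α) (t : ℝ) : α := if t < 0 then a t else b t

theorem switchAtZero_of_neg {α : Type} (a b : ℝ → α) {t : ℝ} (ht : t < 0) :
    switchAtZero a b t = a t := if_pos ht

theorem switchAtZero_of_nonneg {α : Type} (a b : ℝ → α) {t : ℝ} (ht : 0 ≤ t) :
    switchAtZero a b t = b t := if_neg ht.not_gt

theorem switchAtZero_eventuallyEq_of_neg {α : Type} (a b : ℝ → α) {t : ℝ} (ht : t < 0) :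
    switchAtZero a b =ᶠ[𝓝 t] a :=
  (eventually_lt_nhds ht).mono fun _ h => switchAtZero_of_neg a b h

theorem switchAtZero_eventuallyEq_of_pos {α : Type} (a b : ℝ → α) {t : ℝ} (ht : 0 < t) :
    switchAtZero a b =ᶠ[𝓝 t] b :=
  (eventually_gt_nhds ht).mono fun _ h => switchAtZero_of_nonneg a b (le_of_lt h)

variable {N : ℕ} {k l : Fin N}

theorem switchAtZero_eventually_left :
    ∀ᶠ τ in 𝓝[<] (0 : ℝ), switchAtZero (fun _ => k) (fun _ => l) τ = k :=
  eventually_mem_nhdsWithin.mono fun _ h => switchAtZero_of_neg _ _ h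

theorem mem_switchTimes_switchAtZero (hkl : k ≠ l) :
    (0 : ℝ) ∈ switchTimes (switchAtZero (fun _ => k) fun _ => l) := by
  intro h
  rw [switchAtZero_of_nonneg _ _ le_rfl] at h
  obtain ⟨τ, h1, h2⟩ := (h.and switchAtZero_eventually_left).exists
  exact hkl (h2.symm.trans h1)

theorem eq_zero_of_mem_switchTimes {t : ℝ}
    (ht : t ∈ switchTimes (switchAtZero (fun _ => k) fun _ => l)) : t = 0 := by
  by_contra h0
  apply ht
  rcases lt_or_gt_of_ne h0 with h | h
  · rw [switchAtZero_of_neg _ _ h]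
    exact (switchAtZero_eventuallyEq_of_neg _ _ h).filter_mono nhdsWithin_le_nhds
  · rw [switchAtZero_of_nonneg _ _ h.le]
    exact (switchAtZero_eventuallyEq_of_pos _ _ h).filter_mono nhdsWithin_le_nhds

theorem isSwitchingSignal_switchAtZero (k l : Fin N) :
    IsSwitchingSignal (switchAtZero (fun _ => k) fun _ => l) where
  right_continuous t := by
    rcases lt_or_ge t 0 with h | h
    · rw [switchAtZero_of_neg _ _ h]
      exact (switchAtZero_eventuallyEq_of_neg _ _ h).filter_mono nhdsWithin_le_nhds
    · rw [switchAtZero_of_nonneg _ _ h]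
      exact eventually_mem_nhdsWithin.mono fun τ hτ =>
        switchAtZero_of_nonneg _ _ (h.trans (le_of_lt hτ))
  left_limit t := by
    rcases le_or_gt t 0 with h | h
    · exact ⟨k, eventually_mem_nhdsWithin.mono fun τ hτ =>
        switchAtZero_of_neg _ _ (lt_of_lt_of_le hτ h)⟩
    · exact ⟨l, (switchAtZero_eventuallyEq_of_pos _ _ h).filter_mono nhdsWithin_le_nhds⟩
  locally_finite a b :=
    (Set.finite_singleton (0 : ℝ)).subset fun _ ht => eq_zero_of_mem_switchTimes ht.1

variable {S : SLDS N w} {u v : ℝ → Fin w → ℝ}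

theorem SLDS.contDiff_of_mem (hu : u ∈ S.behaviour k) : ContDiff ℝ ∞ u := by
  obtain ⟨g, R, hR⟩ := S.isLinear k
  rw [hR] at hu
  exact hu.1

theorem diffOp_zero {r : Type} (G : Matrix r (Fin w) ℝ[X]) (t : ℝ) :
    diffOp G (0 : ℝ → Fin w → ℝ) t = 0 := by
  ext i
  simp [diffOp, iteratedDeriv_fun_const_zero, Polynomial.sum_def]

theorem SLDS.zero_mem (S : SLDS N w) (k : Fin N) : (0 : ℝ → Fin w → ℝ) ∈ S.behaviour k := by
  obtain ⟨g, R, hR⟩ := S.isLinear k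
  rw [hR]
  exact ⟨contDiff_const, diffOp_zero R⟩

theorem tendsto_switchAtZero_left {E : Type} [TopologicalSpace E]
    (T : (ℝ → Fin w → ℝ) → ℝ → E) (hT : ∀ {f g : ℝ → Fin w → ℝ} {t}, f =ᶠ[𝓝 t] g → T f t = T g t)
    (hu : Continuous (T u)) : Tendsto (T (switchAtZero u v)) (𝓝[<] 0) (𝓝 (T u 0)) :=
  ((hu.tendsto 0).mono_left nhdsWithin_le_nhds).congr'
    (eventually_mem_nhdsWithin.mono fun _ h => (hT (switchAtZero_eventuallyEq_of_neg u v h)).symm)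

theorem tendsto_switchAtZero_right {E : Type} [TopologicalSpace E]
    (T : (ℝ → Fin w → ℝ) → ℝ → E) (hT : ∀ {f g : ℝ → Fin w → ℝ} {t}, f =ᶠ[𝓝 t] g → T f t = T g t)
    (hv : Continuous (T v)) : Tendsto (T (switchAtZero u v)) (𝓝[>] 0) (𝓝 (T v 0)) :=
  ((hv.tendsto 0).mono_left nhdsWithin_le_nhds).congr'
    (eventually_mem_nhdsWithin.mono fun _ h => (hT (switchAtZero_eventuallyEq_of_pos u v h)).symm)

theorem SLDS.switchAtZero_mem (hkl : k ≠ l) (hu : u ∈ S.behaviour k) (hv : v ∈ S.behaviour l)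
    (h : diffOp (S.gMinus k l) u 0 = diffOp (S.gPlus k l) v 0) :
    switchAtZero u v ∈ S.switchedBehaviour (switchAtZero (fun _ => k) fun _ => l) := by
  refine ⟨fun m J _ hJ => ?_, fun t ht m hm => ?_⟩
  · rcases eq_or_ne m k with rfl | hmk
    · refine ⟨u, hu, fun t ht => ?_⟩
      rcases lt_or_ge t 0 with h0 | h0
      · exact switchAtZero_of_neg u v h0
      · exact absurd ((hJ t ht).symm.trans (switchAtZero_of_nonneg _ _ h0)) hkl
    · rcases eq_or_ne m l with rfl | hml
      · refine ⟨v, hv, fun t ht => ?_⟩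
        rcases lt_or_ge t 0 with h0 | h0
        · exact absurd ((hJ t ht).symm.trans (switchAtZero_of_neg _ _ h0)) hmk
        · exact switchAtZero_of_nonneg u v h0
      -- a third mode is never active, so `J` is empty
      · refine ⟨0, S.zero_mem m, fun t ht => ?_⟩
        rcases lt_or_ge t 0 with h0 | h0
        · exact absurd ((hJ t ht).symm.trans (switchAtZero_of_neg _ _ h0)) hmk
        · exact absurd ((hJ t ht).symm.trans (switchAtZero_of_nonneg _ _ h0)) hml
  · obtain rfl := eq_zero_of_mem_switchTimes ht
    obtain ⟨τ, h1, h2⟩ := (hm.and switchAtZero_eventually_left).exists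
    obtain rfl : m = k := h1.symm.trans h2
    have hl : switchAtZero (fun _ => m) (fun _ => l) (0 : ℝ) = l :=
      switchAtZero_of_nonneg _ _ le_rfl
    generalize switchAtZero (fun _ => m) (fun _ => l) (0 : ℝ) = l' at hl
    subst hl
    refine ⟨_, tendsto_switchAtZero_left _ (diffOp_congr _)
      (continuous_diffOp _ (S.contDiff_of_mem hu)), ?_⟩
    rw [h]
    exact tendsto_switchAtZero_right _ (diffOp_congr _)
      (continuous_diffOp _ (S.contDiff_of_mem hv))

theorem SLDS.IsMLF.jump_le {Ψ : Fin N → Matrix (Fin w) (Fin w) (MvPolynomial (Fin 2) ℝ)}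
    (hΨ : S.IsMLF Ψ) (hkl : k ≠ l) (hu : u ∈ S.behaviour k) (hv : v ∈ S.behaviour l)
    (h : diffOp (S.gMinus k l) u 0 = diffOp (S.gPlus k l) v 0) :
    qdf (Ψ l) v 0 ≤ qdf (Ψ k) u 0 := by
  have hs : switchAtZero (fun _ => k) (fun _ => l) (0 : ℝ) = l :=
    switchAtZero_of_nonneg _ _ le_rfl
  refine hΨ.jump _ (isSwitchingSignal_switchAtZero k l) _ (S.switchAtZero_mem hkl hu hv h) 0
    (mem_switchTimes_switchAtZero hkl) k switchAtZero_eventually_left _ _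
    (tendsto_switchAtZero_left _ (qdf_congr _) (continuous_qdf _ (S.contDiff_of_mem hu))) ?_
  rw [hs]
  exact tendsto_switchAtZero_right _ (qdf_congr _) (continuous_qdf _ (S.contDiff_of_mem hv))

end

/-! ### Transfer functions and strict positive-realness -/

section

variable {n : Type} [Fintype n] [DecidableEq n] {w : ℕ} {R : Matrix (Fin w) (Fin w) ℝ[X]}
  {X : Matrix n (Fin w) ℝ[X]} {A : Matrix n n ℝ} {B : Matrix n (Fin w) ℝ}
  {K : Matrix (Fin w) n ℝ}

theorem IsRealization.charmatrix_mul (h : IsRealization R X A B K) :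
    A.charmatrix * X = B.map C * R := by
  rw [Matrix.charmatrix, Matrix.sub_mul, Matrix.scalar_apply, ← Matrix.smul_eq_diagonal_mul,
    h.shift]
  simp

/-- `V X R⁻¹ = V (ξ - A)⁻¹ B`, written with the adjugate over the characteristic polynomial. -/
theorem IsRealization.ratMat_mul_inv_apply (hR : R.det ≠ 0) (h : IsRealization R X A B K)
    (V : Matrix (Fin w) n ℝ) (i j : Fin w) :
    (ratMat (V.map C * X) * (ratMat R)⁻¹) i j =
      algebraMap ℝ[X] (RatFunc ℝ) ((V.map C * A.charmatrix.adjugate * B.map C) i j) /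
        algebraMap ℝ[X] (RatFunc ℝ) A.charpoly := by
  have hχ : algebraMap ℝ[X] (RatFunc ℝ) A.charpoly ≠ 0 := by
    simpa using A.charpoly_monic.ne_zero
  have h1 : A.charpoly • (V.map C * X) = V.map C * A.charmatrix.adjugate * B.map C * R := by
    rw [Matrix.mul_assoc _ (B.map C), ← h.charmatrix_mul, Matrix.mul_assoc,
      ← Matrix.mul_assoc A.charmatrix.adjugate, Matrix.adjugate_mul, Matrix.smul_mul,
      Matrix.one_mul, Matrix.mul_smul]
    rfl
  have h2 : ratMat (A.charpoly • (V.map C * X)) =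
      algebraMap ℝ[X] (RatFunc ℝ) A.charpoly • ratMat (V.map C * X) := by
    ext i j
    simp only [ratMat, Matrix.map_apply, Matrix.smul_apply, smul_eq_mul, map_mul]
  have h3 := ratMat_mul_mul_inv hR (V.map C * A.charmatrix.adjugate * B.map C)
  rw [← h1, h2, Matrix.smul_mul] at h3
  rw [eq_div_iff hχ, mul_comm]
  exact congrFun (congrFun h3 i) j

theorem evalC_mul {r m c : Type} [Fintype m] (F : Matrix r m ℝ[X]) (G : Matrix m c ℝ[X]) (z : ℂ) :
    evalC (F * G) z = evalC F z * evalC G z := Matrix.map_mul (f := aeval z)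

theorem evalC_map_C {r c : Type} (a : Matrix r c ℝ) (z : ℂ) :
    evalC (a.map C) z = a.map (algebraMap ℝ ℂ) := by
  ext i j
  simp [evalC]

theorem evalC_charmatrix (A : Matrix n n ℝ) (z : ℂ) :
    evalC A.charmatrix z = z • 1 - A.map (algebraMap ℝ ℂ) := by
  ext i j
  by_cases hij : i = j
  · subst hij
    simp [evalC]
  · simp [evalC, hij]

theorem aeval_charpoly (A : Matrix n n ℝ) (z : ℂ) :
    aeval z A.charpoly = (z • 1 - A.map (algebraMap ℝ ℂ)).det := by
  rw [← evalC_charmatrix, Matrix.charpoly, AlgHom.map_det]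
  rfl

theorem evalC_adjugate_charmatrix (A : Matrix n n ℝ) (z : ℂ) :
    evalC A.charmatrix.adjugate z = (z • 1 - A.map (algebraMap ℝ ℂ)).adjugate := by
  rw [← evalC_charmatrix]
  exact AlgHom.map_adjugate (aeval z) A.charmatrix

theorem IsRealization.ratEvalC_eq (hR : R.det ≠ 0) (h : IsRealization R X A B K)
    (V : Matrix (Fin w) n ℝ) {z : ℂ} (hz : aeval z A.charpoly ≠ 0) :
    ratEvalC (ratMat (V.map C * X) * (ratMat R)⁻¹) z =
      V.map (algebraMap ℝ ℂ) * (z • 1 - A.map (algebraMap ℝ ℂ))⁻¹ * B.map (algebraMap ℝ ℂ) := by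
  have h1 : V.map (algebraMap ℝ ℂ) * (z • 1 - A.map (algebraMap ℝ ℂ))⁻¹ * B.map (algebraMap ℝ ℂ) =
      (aeval z A.charpoly)⁻¹ • evalC (V.map C * A.charmatrix.adjugate * B.map C) z := by
    rw [evalC_mul, evalC_mul, evalC_map_C, evalC_map_C, evalC_adjugate_charmatrix, Matrix.inv_def,
      ← aeval_charpoly, Ring.inverse_eq_inv', Matrix.mul_smul, Matrix.smul_mul]
  rw [h1]
  ext i j
  simp only [ratEvalC, Matrix.map_apply, h.ratMat_mul_inv_apply hR, Matrix.smul_apply, evalC,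
    smul_eq_mul]
  rw [eval_div_eq _ hz, div_eq_inv_mul]

omit [Fintype n] [DecidableEq n] in
theorem map_algebraMap_conjTranspose {m : Type} (a : Matrix m n ℝ) :
    (a.map (algebraMap ℝ ℂ)).conjTranspose = a.transpose.map (algebraMap ℝ ℂ) := by
  ext i j
  simp

/-- If `P` is symmetric, `AᵀP + PA = -LᵀL`, `A` has no eigenvalue in the closed right half-plane
and `L X` has full column rank on the imaginary axis, then `BᵀP X R⁻¹ = BᵀP (ξ - A)⁻¹ B` is
strictly positive-real: with `H = (jω - A)⁻¹ B`, its Hermitian part on the axis is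
`(L H)* (L H)`. -/
theorem IsRealization.isStrictlyPositiveReal (hR : R.det ≠ 0) (h : IsRealization R X A B K)
    {q : ℕ} {P : Matrix n n ℝ} {L : Matrix (Fin q) n ℝ} (hP : P.transpose = P)
    (hL : A.transpose * P + P * A = -(L.transpose * L))
    (hA : ∀ z : ℂ, 0 ≤ z.re → aeval z A.charpoly ≠ 0)
    (hrank : ∀ y : ℝ, (evalC (L.map C * X) (Complex.I * (y : ℂ))).rank = w) :
    IsStrictlyPositiveReal (ratMat ((B.transpose * P).map C * X) * (ratMat R)⁻¹) where
  analytic i j := by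
    have h1 : ∀ p : ℝ[X], AnalyticOnNhd ℂ (fun z => aeval z p) {z : ℂ | 0 < z.re} :=
      fun p => AnalyticOnNhd.aeval_polynomial analyticOnNhd_id p
    refine (h1 _).div (h1 _) fun z hz => ?_
    rw [h.ratMat_mul_inv_apply hR]
    exact aeval_denom_div_ne_zero _ (hA z (le_of_lt hz))
  no_pole_axis i j y := by
    rw [h.ratMat_mul_inv_apply hR]
    exact aeval_denom_div_ne_zero _ (hA _ (by simp))
  pos y := by
    set z : ℂ := Complex.I * (y : ℂ) with hz
    have hz0 : aeval z A.charpoly ≠ 0 := hA z (by simp [hz])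
    have hz1 : aeval (-z) A.charpoly ≠ 0 := hA (-z) (by simp [hz])
    have hzc : star z = -z := by simp [hz]
    rw [h.ratEvalC_eq hR _ hz0, h.ratEvalC_eq hR _ hz1]
    set Ac := A.map (algebraMap ℝ ℂ) with hAc
    set Bc := B.map (algebraMap ℝ ℂ) with hBc
    set Pc := P.map (algebraMap ℝ ℂ) with hPc
    set Lc := L.map (algebraMap ℝ ℂ) with hLc
    set T := z • (1 : Matrix n n ℂ) - Ac with hT
    have hTu : IsUnit T.det := by rw [hT, ← aeval_charpoly, isUnit_iff_ne_zero]; exact hz0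
    obtain ⟨H, hH⟩ : ∃ H, H = T⁻¹ * Bc := ⟨_, rfl⟩
    have hB : Bc = T * H := by rw [hH, Matrix.mul_nonsing_inv_cancel_left _ _ hTu]
    have hBt : (B.transpose).map (algebraMap ℝ ℂ) = Bc.conjTranspose :=
      (map_algebraMap_conjTranspose B).symm
    have hTt : ((-z) • (1 : Matrix n n ℂ) - Ac).transpose = T.conjTranspose := by
      rw [hT, Matrix.conjTranspose_sub, hAc, map_algebraMap_conjTranspose,
        Matrix.conjTranspose_smul, hzc, Matrix.transpose_sub,
        Matrix.transpose_smul, Matrix.transpose_one, Matrix.conjTranspose_one, Matrix.transpose_map]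
    have hkey : Pc * T + T.conjTranspose * Pc = Lc.conjTranspose * Lc := by
      have h2 := congrArg (fun M => M.map (algebraMap ℝ ℂ)) hL
      simp only [Matrix.map_add _ (map_add (algebraMap ℝ ℂ)), Matrix.map_mul,
        Matrix.map_neg _ (map_neg (algebraMap ℝ ℂ))] at h2
      rw [← map_algebraMap_conjTranspose, ← map_algebraMap_conjTranspose] at h2
      rw [eq_neg_iff_add_eq_zero] at h2
      rw [hT, Matrix.conjTranspose_sub, Matrix.conjTranspose_smul, hzc, Matrix.mul_sub,
        Matrix.sub_mul]
      simp only [Matrix.conjTranspose_one, Matrix.mul_smul, Matrix.mul_one, Matrix.smul_mul,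
        Matrix.one_mul]
      rw [← sub_eq_zero, ← neg_eq_zero, ← h2, neg_smul]
      abel
    have hmain : ((B.transpose * P).map (algebraMap ℝ ℂ) *
        ((-z) • (1 : Matrix n n ℂ) - Ac)⁻¹ * Bc).transpose +
        (B.transpose * P).map (algebraMap ℝ ℂ) * T⁻¹ * Bc =
        (Lc * H).conjTranspose * (Lc * H) := by
      have e1 : ((B.transpose * P).map (algebraMap ℝ ℂ) *
          ((-z) • (1 : Matrix n n ℂ) - Ac)⁻¹ * Bc).transpose = H.conjTranspose * Pc * Bc := by
        have e0 : ((B.transpose * P).map (algebraMap ℝ ℂ)).transpose = Pc * Bc := by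
          rw [← Matrix.transpose_map, Matrix.transpose_mul, hP, Matrix.transpose_transpose,
            Matrix.map_mul]
        have e2 : Bc.transpose = Bc.conjTranspose := by rw [← hBt, Matrix.transpose_map]
        rw [Matrix.transpose_mul, Matrix.transpose_mul, Matrix.transpose_nonsing_inv, hTt, e0, e2,
          hH, Matrix.conjTranspose_mul, Matrix.conjTranspose_nonsing_inv]
        simp only [Matrix.mul_assoc]
      rw [e1, Matrix.mul_assoc _ T⁻¹, ← hH, Matrix.map_mul, hBt, ← hPc]
      calc H.conjTranspose * Pc * Bc + Bc.conjTranspose * Pc * H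
          = H.conjTranspose * (Pc * T + T.conjTranspose * Pc) * H := by
            rw [hB, Matrix.conjTranspose_mul]
            simp only [Matrix.mul_add, Matrix.add_mul, Matrix.mul_assoc]
        _ = (Lc * H).conjTranspose * (Lc * H) := by
            rw [hkey, Matrix.conjTranspose_mul]
            simp only [Matrix.mul_assoc]
    rw [hmain]
    refine Matrix.PosDef.conjTranspose_mul_self _ ?_
    have hQ : evalC (L.map C * X) z = (Lc * H) * evalC R z := by
      have h3 : T * evalC X z = Bc * evalC R z := by
        rw [hT, hAc, ← evalC_charmatrix, ← evalC_mul, h.charmatrix_mul, evalC_mul, evalC_map_C]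
      have h4 : evalC X z = H * evalC R z := by
        rw [hH, Matrix.mul_assoc, ← h3, Matrix.nonsing_inv_mul_cancel_left _ _ hTu]
      rw [evalC_mul, evalC_map_C, h4, Matrix.mul_assoc, hLc]
    have h5 : w ≤ (Lc * H).rank := by
      refine (hrank y).ge.trans ?_
      rw [← hz, hQ]
      exact Matrix.rank_mul_le_left _ _
    have h6 : Module.finrank ℂ (LinearMap.ker (Lc * H).mulVecLin) = 0 := by
      have := (Lc * H).mulVecLin.finrank_range_add_finrank_ker
      rw [Module.finrank_fin_fun] at this
      change w ≤ Module.finrank ℂ (LinearMap.range (Lc * H).mulVecLin) at h5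
      omega
    exact LinearMap.ker_eq_bot.1 (Submodule.finrank_eq_zero.1 h6)

end

/-! ### Stability of the first mode -/

section

variable {n : Type} [Fintype n] {w : ℕ} {R : Matrix (Fin w) (Fin w) ℝ[X]}
  {X : Matrix n (Fin w) ℝ[X]} {A : Matrix n n ℝ} {B : Matrix n (Fin w) ℝ}
  {K : Matrix (Fin w) n ℝ}

/-- If `A x = a x - b y` and `A y = a y + b x`, then `x + j y` is an eigenvector of `A` for
`a + j b`, and the real part of `e^{(a + j b) t} (x + j y)` solves the state equation. -/
theorem isStateTrajectory_of_eigenpair {a b : ℝ} {x y : n → ℝ}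
    (hx : A.mulVec x = a • x - b • y) (hy : A.mulVec y = a • y + b • x) :
    IsStateTrajectory A fun t =>
      Real.exp (a * t) • (Real.cos (b * t) • x - Real.sin (b * t) • y) := by
  intro t
  have h1 : HasDerivAt (fun t : ℝ => b * t) b t := by simpa using (hasDerivAt_id t).const_mul b
  have h2 : HasDerivAt (fun t : ℝ => a * t) a t := by simpa using (hasDerivAt_id t).const_mul a
  have h3 := h2.exp.fun_smul ((h1.cos.smul_const x).fun_sub (h1.sin.smul_const y))
  refine h3.congr_deriv ?_
  rw [Matrix.mulVec_smul, Matrix.mulVec_sub, Matrix.mulVec_smul, Matrix.mulVec_smul, hx, hy]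
  module

theorem dotProduct_mulVec_lyapunov {q : Type} [Fintype q] {P : Matrix n n ℝ} {L : Matrix q n ℝ}
    (hL : A.transpose * P + P * A = -(L.transpose * L)) (x : n → ℝ) :
    dotProduct (A.mulVec x) (P.mulVec x) + dotProduct x (P.mulVec (A.mulVec x)) =
      -dotProduct (L.mulVec x) (L.mulVec x) := by
  have h := congrArg (fun M => dotProduct x (M.mulVec x)) hL
  simp only [Matrix.add_mulVec, Matrix.neg_mulVec, ← Matrix.mulVec_mulVec, dotProduct_add,
    dotProduct_neg] at h
  rw [Matrix.dotProduct_mulVec x A.transpose, Matrix.vecMul_transpose,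
    Matrix.dotProduct_mulVec x L.transpose, Matrix.vecMul_transpose] at h
  exact h

theorem dotProduct_mulVec_comm_of_transpose_eq {P : Matrix n n ℝ} (hP : P.transpose = P)
    (x y : n → ℝ) : dotProduct x (P.mulVec y) = dotProduct y (P.mulVec x) := by
  rw [Matrix.dotProduct_mulVec, ← Matrix.mulVec_transpose, hP, dotProduct_comm]

variable [DecidableEq n]

/-- If `P ≥ 0` solves the Lyapunov equation `AᵀP + PA = -LᵀL` and no nonzero solution of `x' = A x`
satisfies `L x = 0` throughout, then `A` has no eigenvalue in the closed right half-plane. -/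
theorem aeval_charpoly_ne_zero_of_lyapunov {q : Type} [Fintype q] {P : Matrix n n ℝ}
    {L : Matrix q n ℝ}
    (hP : P.transpose = P) (hpos : ∀ x, 0 ≤ dotProduct x (P.mulVec x))
    (hL : A.transpose * P + P * A = -(L.transpose * L))
    (hobs : ∀ x, IsStateTrajectory A x → (∀ t, L.mulVec (x t) = 0) → x 0 = 0)
    {z : ℂ} (hz : 0 ≤ z.re) : aeval z A.charpoly ≠ 0 := by
  intro h0
  rw [aeval_charpoly, ← Matrix.exists_mulVec_eq_zero_iff] at h0
  obtain ⟨v, hv0, hv⟩ := h0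
  rw [Matrix.sub_mulVec, Matrix.smul_mulVec, Matrix.one_mulVec, sub_eq_zero] at hv
  let x : n → ℝ := fun i => (v i).re
  let y : n → ℝ := fun i => (v i).im
  have hx : A.mulVec x = z.re • x - z.im • y := by
    ext i
    have := congrArg Complex.re (congrFun hv i)
    simpa [Matrix.mulVec, dotProduct, x, y] using this.symm
  have hy : A.mulVec y = z.re • y + z.im • x := by
    ext i
    have := congrArg Complex.im (congrFun hv i)
    simpa [Matrix.mulVec, dotProduct, x, y] using this.symm
  have ex := dotProduct_mulVec_lyapunov hL x
  have ey := dotProduct_mulVec_lyapunov hL y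
  rw [dotProduct_mulVec_comm_of_transpose_eq hP x, hx, sub_dotProduct, smul_dotProduct,
    smul_dotProduct] at ex
  rw [dotProduct_mulVec_comm_of_transpose_eq hP y (A.mulVec y), hy, add_dotProduct,
    smul_dotProduct, smul_dotProduct, dotProduct_mulVec_comm_of_transpose_eq hP x y] at ey
  simp only [smul_eq_mul] at ex ey
  -- the real part of the Lyapunov equation at the eigenvector
  have hsum : dotProduct (L.mulVec x) (L.mulVec x) + dotProduct (L.mulVec y) (L.mulVec y) =
      -(2 * (z.re * (dotProduct x (P.mulVec x) + dotProduct y (P.mulVec y)))) := by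
    linarith
  have hnn := mul_nonneg hz (add_nonneg (hpos x) (hpos y))
  have hLx0 : 0 ≤ dotProduct (L.mulVec x) (L.mulVec x) :=
    Finset.sum_nonneg fun _ _ => mul_self_nonneg _
  have hLy0 : 0 ≤ dotProduct (L.mulVec y) (L.mulVec y) :=
    Finset.sum_nonneg fun _ _ => mul_self_nonneg _
  have hLx : L.mulVec x = 0 := dotProduct_self_eq_zero.1 (by linarith)
  have hLy : L.mulVec y = 0 := dotProduct_self_eq_zero.1 (by linarith)
  have hx0 : x = 0 := by
    have := hobs _ (isStateTrajectory_of_eigenpair hx hy) fun t => by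
      simp [Matrix.mulVec_smul, Matrix.mulVec_sub, hLx, hLy]
    simpa using this
  -- the pair `(y, -x)` belongs to the eigenvector `-j (x + j y)`
  have hy0 : y = 0 := by
    have hxn : A.mulVec (-x) = z.re • (-x) + z.im • y := by
      rw [Matrix.mulVec_neg, hx]
      module
    have hyn : A.mulVec y = z.re • y - z.im • (-x) := by
      rw [hy]
      module
    have := hobs _ (isStateTrajectory_of_eigenpair hyn hxn) fun t => by
      rw [Matrix.mulVec_smul, Matrix.mulVec_sub, Matrix.mulVec_smul, Matrix.mulVec_smul,
        Matrix.mulVec_neg, hLx, hLy]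
      simp
    simpa using this
  exact hv0 (funext fun i => Complex.ext (congrFun hx0 i) (congrFun hy0 i))

end

/-! ### Structure of the storage function and the completion -/

section

variable {m d : Type} [Fintype m] [Fintype d]

/-- A linear term dominated by a quadratic one vanishes. -/
theorem eq_zero_of_forall_nonneg {b c : ℝ} (hc : 0 ≤ c)
    (h : ∀ s : ℝ, 0 ≤ 2 * s * b + s ^ 2 * c) : b = 0 := by
  have hk : 0 < c + 1 := by linarith
  have h1 := h (-b / (c + 1))
  have h2 : 2 * (-b / (c + 1)) * b + (-b / (c + 1)) ^ 2 * c =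
      -(b ^ 2 * ((c + 2) / (c + 1) ^ 2)) := by
    field_simp
    ring
  rw [h2] at h1
  have h3 : 0 < (c + 2) / (c + 1) ^ 2 := by positivity
  by_contra hb
  have : 0 < b ^ 2 * ((c + 2) / (c + 1) ^ 2) := by positivity
  linarith

/-- If, for every `u`, the form `xᵀPx` restricted to `x = (u, y)` is minimal at `y = T u`, then the
lower block row of `P` annihilates the vectors `(u, T u)`. -/
theorem toBlocks₂₁_eq_neg_mul {P : Matrix (m ⊕ d) (m ⊕ d) ℝ} {T : Matrix d m ℝ}
    (hP : P.transpose = P) (hpos : ∀ x, 0 ≤ dotProduct x (P.mulVec x))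
    (hmin : ∀ u y, dotProduct (Sum.elim u (T.mulVec u)) (P.mulVec (Sum.elim u (T.mulVec u))) ≤
      dotProduct (Sum.elim u y) (P.mulVec (Sum.elim u y))) :
    P.toBlocks₂₁ = -(P.toBlocks₂₂ * T) := by
  classical
  rw [eq_neg_iff_add_eq_zero, ← Matrix.mulVec_injective.eq_iff]
  ext1 u
  rw [Matrix.zero_mulVec]
  set g := (P.toBlocks₂₁ + P.toBlocks₂₂ * T).mulVec u with hg
  set e : m ⊕ d → ℝ := Sum.elim u (T.mulVec u) with he
  set f : m ⊕ d → ℝ := Sum.elim 0 g with hf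
  have hfe : dotProduct f (P.mulVec e) = dotProduct g g := by
    rw [he, hf, ← Matrix.fromBlocks_toBlocks P, Matrix.fromBlocks_mulVec,
      sumElim_dotProduct_sumElim, zero_dotProduct, zero_add, Sum.elim_comp_inl,
      Sum.elim_comp_inr, Matrix.mulVec_mulVec, ← Matrix.add_mulVec]
  -- `g` is half the gradient at `y = T u`; move from the minimum in this direction
  have hgg : dotProduct g g = 0 := by
    refine eq_zero_of_forall_nonneg (hpos f) fun s => ?_
    have h1 := hmin u (T.mulVec u + s • g)
    have h2 : Sum.elim u (T.mulVec u + s • g) = e + s • f := by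
      ext i
      rcases i with i | i <;> simp [he, hf]
    rw [h2, Matrix.mulVec_add, Matrix.mulVec_smul, add_dotProduct, dotProduct_add, dotProduct_add,
      dotProduct_smul, smul_dotProduct, smul_dotProduct, dotProduct_smul,
      dotProduct_mulVec_comm_of_transpose_eq hP e f, hfe] at h1
    simp only [smul_eq_mul] at h1
    linarith
  exact dotProduct_self_eq_zero.1 hgg

end

section

variable {n : Type} [Fintype n] {w : ℕ} {R : Matrix (Fin w) (Fin w) ℝ[X]}
  {X : Matrix n (Fin w) ℝ[X]} {A : Matrix n n ℝ} {B : Matrix n (Fin w) ℝ}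
  {K : Matrix (Fin w) n ℝ}

/-- A row of the state map for which `ξ X R⁻¹` is still strictly proper is not driven by the
input. -/
theorem IsRealization.input_eq_zero (hR : R.det ≠ 0) (hX : IsMinimalStateMap R X)
    (h : IsRealization R X A B K) {i : n} {j : Fin w}
    (hi : RatDegLE (-1) (algebraMap ℝ[X] (RatFunc ℝ) Polynomial.X *
      (ratMat X * (ratMat R)⁻¹) i j)) : B i j = 0 := by
  have h1 : ratMat ((Polynomial.X : ℝ[X]) • X) * (ratMat R)⁻¹ =
      ratMat (A.map C) * (ratMat X * (ratMat R)⁻¹) + ratMat (B.map C) := by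
    rw [h.shift, ratMat_add, Matrix.add_mul, ratMat_mul_mul_inv hR, ratMat_mul, Matrix.mul_assoc]
  have h2 : (ratMat ((Polynomial.X : ℝ[X]) • X) * (ratMat R)⁻¹) i j =
      algebraMap ℝ[X] (RatFunc ℝ) Polynomial.X * (ratMat X * (ratMat R)⁻¹) i j := by
    simp [ratMat, Matrix.mul_apply, Finset.mul_sum, mul_assoc]
  have h3 := (isStrictlyProper_iff _).1 (hX.isStrictlyProper.const_mul A) i j
  rw [← h2] at hi
  have h4 := hi.sub h3
  rw [h1, Matrix.add_apply, add_sub_cancel_left] at h4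
  simpa using eq_zero_of_ratDegLE h4

end

namespace StandardSLDS

variable {w : ℕ} (S : StandardSLDS w)

/-- The state map `col(X₂, X₁')` of the first mode. -/
noncomputable def X₁ : Matrix (Fin S.n₂ ⊕ Fin S.d) (Fin w) ℝ[X] := Matrix.fromRows S.X₂ S.X₁'

theorem isMinimalStateMap_X₁ : IsMinimalStateMap S.R₁ S.X₁ := S.minimal₁

variable {S} {A : Matrix (Fin S.n₂ ⊕ Fin S.d) (Fin S.n₂ ⊕ Fin S.d) ℝ}
  {B : Matrix (Fin S.n₂ ⊕ Fin S.d) (Fin w) ℝ} {K : Matrix (Fin w) (Fin S.n₂ ⊕ Fin S.d) ℝ}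

/-- As `X₂ R₂⁻¹` and `R₂ R₁⁻¹` are strictly proper, `ξ X₂ R₁⁻¹` is strictly proper, so that the
input matrix of the first mode vanishes on the common part of the state. -/
theorem input_inl_eq_zero (h : IsRealization S.R₁ S.X₁ A B K) (i : Fin S.n₂) (j : Fin w) :
    B (Sum.inl i) j = 0 := by
  refine h.input_eq_zero S.det_R₁ S.isMinimalStateMap_X₁ ?_
  have h1 : (ratMat S.X₁ * (ratMat S.R₁)⁻¹) (Sum.inl i) j =
      (ratMat S.X₂ * (ratMat S.R₂)⁻¹ * (ratMat S.R₂ * (ratMat S.R₁)⁻¹)) i j := by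
    rw [← Matrix.mul_assoc, Matrix.nonsing_inv_mul_cancel_right _ _ (isUnit_det_ratMat S.det_R₂)]
    rfl
  rw [h1, Matrix.mul_apply, Finset.mul_sum]
  refine RatDegLE.sum _ _ fun k _ => ?_
  have h2 := (isStrictlyProper_iff _).1 S.minimal₂.isStrictlyProper i k
  have h3 := (isStrictlyProper_iff _).1 S.strictlyProper k j
  exact ratDegLE_X.mul (h2.mul h3)

/-- If the lower block row of `P` annihilates the vectors `(u, Π u)`, then `BᵀP X₁` is a left
multiple of `R₂`. -/
theorem exists_mul_R₂_eq (h : IsRealization S.R₁ S.X₁ A B K)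
    {P : Matrix (Fin S.n₂ ⊕ Fin S.d) (Fin S.n₂ ⊕ Fin S.d) ℝ}
    (hP : P.toBlocks₂₁ = -(P.toBlocks₂₂ * S.P)) :
    ∃ M : Matrix (Fin w) (Fin w) ℝ[X], (B.transpose * P).map C * S.X₁ = M * S.R₂ := by
  obtain ⟨-, N, hN⟩ := S.mod_eq
  have hB : B = Matrix.fromRows 0 B.toRows₂ := by
    conv_lhs => rw [← Matrix.fromRows_toRows B]
    congr 1
    ext i j
    exact input_inl_eq_zero h i j
  refine ⟨(B.toRows₂.transpose * P.toBlocks₂₂).map C * N, ?_⟩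
  have h1 : B.transpose * P = Matrix.fromCols (-(B.toRows₂.transpose * P.toBlocks₂₂ * S.P))
      (B.toRows₂.transpose * P.toBlocks₂₂) := by
    conv_lhs => rw [hB, ← Matrix.fromBlocks_toBlocks P]
    rw [Matrix.transpose_fromRows, Matrix.fromCols_mul_fromBlocks, hP]
    simp [Matrix.mul_assoc]
  rw [h1, Matrix.fromCols_map, X₁, Matrix.fromCols_mul_fromRows, hN,
    Matrix.map_neg _ (map_neg (C : ℝ →+* ℝ[X])), Matrix.map_mul (f := (C : ℝ →+* ℝ[X]))
      (L := B.toRows₂.transpose * P.toBlocks₂₂)]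
  simp only [Matrix.mul_add, Matrix.neg_mul, Matrix.mul_assoc]
  abel

end StandardSLDS

/-! ### Storage functions in state coordinates -/

section

variable {n : Type} [Fintype n] [DecidableEq n] {w : ℕ} {R : Matrix (Fin w) (Fin w) ℝ[X]}
  {X : Matrix n (Fin w) ℝ[X]} {A : Matrix n n ℝ} {B : Matrix n (Fin w) ℝ}
  {K : Matrix (Fin w) n ℝ}

/-- The symmetric matrix of the quadratic form in the state which represents `Q_Φ`. -/
noncomputable def symStateForm (A : Matrix n n ℝ) (K : Matrix (Fin w) n ℝ)
    (Φ : Matrix (Fin w) (Fin w) (MvPolynomial (Fin 2) ℝ)) : Matrix n n ℝ :=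
  (2⁻¹ : ℝ) • (stateForm A K Φ + (stateForm A K Φ).transpose)

theorem transpose_symStateForm (Φ : Matrix (Fin w) (Fin w) (MvPolynomial (Fin 2) ℝ)) :
    (symStateForm A K Φ).transpose = symStateForm A K Φ := by
  rw [symStateForm, Matrix.transpose_smul, Matrix.transpose_add, Matrix.transpose_transpose,
    add_comm]

theorem IsStateTrajectory.qdf_eq_symStateForm {x : ℝ → n → ℝ} (hx : IsStateTrajectory A x)
    (Φ : Matrix (Fin w) (Fin w) (MvPolynomial (Fin 2) ℝ)) (t : ℝ) :
    qdf Φ (fun τ => K.mulVec (x τ)) t =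
      dotProduct (x t) ((symStateForm A K Φ).mulVec (x t)) := by
  rw [hx.qdf_eq, symStateForm, Matrix.smul_mulVec, Matrix.add_mulVec, dotProduct_smul,
    dotProduct_add, Matrix.mulVec_transpose, dotProduct_comm (x t) (Matrix.vecMul _ _),
    ← Matrix.dotProduct_mulVec, smul_eq_mul]
  ring

/-- The dissipation equality `(ζ + η) Ψ mod R = -Q(ζ)ᵀ Q(η)` is a Lyapunov equation for the matrix
representing `Ψ`. -/
theorem lyapunov_of_isMod₂ (hR : R.det ≠ 0) (hX : IsMinimalStateMap R X)
    (h : IsRealization R X A B K) {Ψ : Matrix (Fin w) (Fin w) (MvPolynomial (Fin 2) ℝ)} {q : ℕ}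
    {Q : Matrix (Fin q) (Fin w) ℝ[X]}
    (hQ : IsMod₂ R (zetaAddEta Ψ) (-((atZeta Q).transpose * atEta Q))) :
    A.transpose * symStateForm A K Ψ + symStateForm A K Ψ * A =
      -((stateCoeff A K Q).transpose * stateCoeff A K Q) := by
  obtain ⟨p, M, N, M', N', h1, ⟨-, U, hU⟩, ⟨-, V, hV⟩, h2⟩ := hQ
  have h3 : A.transpose * stateForm A K Ψ + stateForm A K Ψ * A =
      -((stateCoeff A K Q).transpose * stateCoeff A K Q) := by
    rw [← stateForm_zetaAddEta, h1, stateForm_mul, stateCoeff_eq_of_eq_add hR hX h hU,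
      stateCoeff_eq_of_eq_add hR hX h hV, ← stateForm_mul, ← h2, stateForm_neg, stateForm_mul]
  have h4 := congrArg Matrix.transpose h3
  simp only [Matrix.transpose_add, Matrix.transpose_mul, Matrix.transpose_transpose,
    Matrix.transpose_neg] at h4
  have h5 : A.transpose * symStateForm A K Ψ + symStateForm A K Ψ * A =
      (2⁻¹ : ℝ) • ((A.transpose * stateForm A K Ψ + stateForm A K Ψ * A) +
        ((stateForm A K Ψ).transpose * A + A.transpose * (stateForm A K Ψ).transpose)) := by
    rw [symStateForm, Matrix.mul_smul, Matrix.smul_mul, ← smul_add, Matrix.mul_add,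
      Matrix.add_mul]
    congr 1
    abel
  rw [h5, h3, h4]
  module

theorem exists_kerD_trajectory (hR : R.det ≠ 0) (hX : IsMinimalStateMap R X)
    (h : IsRealization R X A B K) (x₀ : n → ℝ) :
    ∃ x, IsStateTrajectory A x ∧ x 0 = x₀ ∧ (fun t => K.mulVec (x t)) ∈ kerD R ∧
      diffOp X (fun t => K.mulVec (x t)) 0 = x₀ := by
  obtain ⟨x, hx, hx0⟩ := exists_isStateTrajectory A x₀
  refine ⟨x, hx, hx0, hx.mem_kerD hR hX h, ?_⟩
  rw [hx.diffOp_eq, stateCoeff_stateMap hR hX h, Matrix.one_mulVec, hx0]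

omit [DecidableEq n] in
/-- Along a state trajectory, the derivative of the storage function is minus the squared norm of
the dissipation output `L x`. -/
theorem IsStateTrajectory.hasDerivAt_quadratic {q : Type} [Fintype q] {x : ℝ → n → ℝ}
    (hx : IsStateTrajectory A x) {P : Matrix n n ℝ} {L : Matrix q n ℝ}
    (hL : A.transpose * P + P * A = -(L.transpose * L)) (t : ℝ) :
    HasDerivAt (fun τ => dotProduct (x τ) (P.mulVec (x τ)))
      (-dotProduct (L.mulVec (x t)) (L.mulVec (x t))) t := by
  rw [← dotProduct_mulVec_lyapunov hL]
  have h1 : ∀ i, HasDerivAt (fun τ => P.mulVec (x τ) i) (P.mulVec (A.mulVec (x t)) i) t :=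
    fun i => hx.hasDerivAt_dotProduct (P i) t
  have h2 := HasDerivAt.fun_sum (u := Finset.univ) fun i _ =>
    (hasDerivAt_pi.1 (hx t) i).fun_mul (h1 i)
  refine h2.congr_deriv ?_
  rw [Finset.sum_add_distrib]
  rfl

end

theorem diffOp_fromRows {r₁ r₂ : Type} {w : ℕ} (F : Matrix r₁ (Fin w) ℝ[X])
    (G : Matrix r₂ (Fin w) ℝ[X]) (v : ℝ → Fin w → ℝ) (t : ℝ) :
    diffOp (Matrix.fromRows F G) v t = Sum.elim (diffOp F v t) (diffOp G v t) := by
  ext i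
  rcases i with i | i <;> rfl

/-! ### The first mode of a standard switched system -/

namespace StandardSLDS

variable {w : ℕ} {S : StandardSLDS w} {A : Matrix (Fin S.n₂ ⊕ Fin S.d) (Fin S.n₂ ⊕ Fin S.d) ℝ}
  {B : Matrix (Fin S.n₂ ⊕ Fin S.d) (Fin w) ℝ} {K : Matrix (Fin w) (Fin S.n₂ ⊕ Fin S.d) ℝ}
  {Ψ₁ Ψ₂ : Matrix (Fin w) (Fin w) (MvPolynomial (Fin 2) ℝ)}

/-- The two switching conditions together say that, among the states `(u, y)` of the first mode
with given `u`, the storage function is smallest at `y = Π u`: switching `1 → 2` at `(u, y)` bounds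
it below by the storage of the second mode at `u`, and switching `2 → 1` at `u`, which leads to
`(u, Π u)`, bounds it above by the same value. -/
theorem storage_min (hMLF : S.toSLDS.IsMLF ![Ψ₁, Ψ₂]) (h : IsRealization S.R₁ S.X₁ A B K)
    (u : Fin S.n₂ → ℝ) (y : Fin S.d → ℝ) :
    dotProduct (Sum.elim u (S.P.mulVec u))
        ((symStateForm A K Ψ₁).mulVec (Sum.elim u (S.P.mulVec u))) ≤
      dotProduct (Sum.elim u y) ((symStateForm A K Ψ₁).mulVec (Sum.elim u y)) := by
  obtain ⟨A₂, B₂, K₂, h₂⟩ := S.minimal₂.exists_isRealization S.det_R₂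
  obtain ⟨z, hz, hz0, hzB, hzX⟩ := exists_kerD_trajectory S.det_R₂ S.minimal₂ h₂ u
  have hzP : diffOp (S.P.map C * S.X₂) (fun t => K₂.mulVec (z t)) 0 = S.P.mulVec u := by
    rw [hz.diffOp_eq, stateCoeff_const_mul S.det_R₂ S.minimal₂ h₂, hz0]
  obtain ⟨x, hx, hx0, hxB, hxX⟩ := exists_kerD_trajectory S.det_R₁ S.isMinimalStateMap_X₁ h
    (Sum.elim u y)
  obtain ⟨x', hx', hx'0, hxB', hxX'⟩ := exists_kerD_trajectory S.det_R₁ S.isMinimalStateMap_X₁ h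
    (Sum.elim u (S.P.mulVec u))
  have h12 := hMLF.jump_le (k := 0) (l := 1) (by decide) hxB hzB (by
    change diffOp S.X₂ _ 0 = diffOp S.X₂ _ 0
    rw [hzX]
    ext i
    exact congrFun hxX (Sum.inl i))
  have h21 := hMLF.jump_le (k := 1) (l := 0) (by decide) hzB hxB' (by
    change diffOp (Matrix.fromRows S.X₂ (S.P.map C * S.X₂)) _ 0 = diffOp S.X₁ _ 0
    rw [diffOp_fromRows, hzX, hzP, hxX'])
  have h3 := h21.trans h12
  change qdf Ψ₁ _ 0 ≤ qdf Ψ₁ _ 0 at h3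
  rwa [hx.qdf_eq_symStateForm, hx'.qdf_eq_symStateForm, hx0, hx'0] at h3

end StandardSLDS

end SwitchedLDS

theorem mainTheorem4 {w : ℕ} (S : SwitchedLDS.StandardSLDS w)
    (Ψ₁ Ψ₂ : Matrix (Fin w) (Fin w) (MvPolynomial (Fin 2) ℝ))
    (hΨ₂ : SwitchedLDS.IsMod₂ S.R₂ Ψ₁ Ψ₂)
    (hMLF : S.toSLDS.IsMLF ![Ψ₁, Ψ₂])
    {q : ℕ} (Q : Matrix (Fin q) (Fin w) ℝ[X])
    (hQ : SwitchedLDS.IsMod₂ S.R₁ (SwitchedLDS.zetaAddEta Ψ₁)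
      (-((SwitchedLDS.atZeta Q).transpose * SwitchedLDS.atEta Q)))
    (hrank : ∀ y : ℝ, (SwitchedLDS.evalC Q (Complex.I * (y : ℂ))).rank = w)
    (hproper : SwitchedLDS.IsStrictlyProper
      (SwitchedLDS.ratMat Q * (SwitchedLDS.ratMat S.R₁)⁻¹)) :
    ∃ M : Matrix (Fin w) (Fin w) ℝ[X],
      SwitchedLDS.IsSPRCompletion S.R₁ S.R₂ M ∧
      SwitchedLDS.IsStrictlyProper
        (SwitchedLDS.ratMat M * SwitchedLDS.ratMat S.R₂ * (SwitchedLDS.ratMat S.R₁)⁻¹) := by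
  open SwitchedLDS in
  have hX := S.isMinimalStateMap_X₁
  obtain ⟨A, B, K, h⟩ := hX.exists_isRealization S.det_R₁
  have hP := transpose_symStateForm (A := A) (K := K) Ψ₁
  have hL := lyapunov_of_isMod₂ S.det_R₁ hX h hQ
  have hmin := S.storage_min hMLF h
  set P := symStateForm A K Ψ₁
  -- as `Q R₁⁻¹` is strictly proper, `Q` is exactly `L X₁` for a real matrix `L`
  obtain ⟨L, hLQ⟩ := hX.exists_eq hproper
  have hcoeff : stateCoeff A K Q = L := by rw [hLQ, stateCoeff_const_mul S.det_R₁ hX h]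
  rw [hcoeff] at hL
  have hpos : ∀ x, 0 ≤ dotProduct x (P.mulVec x) := by
    intro x₀
    obtain ⟨x, hx, hx0, hxB, -⟩ := exists_kerD_trajectory S.det_R₁ hX h x₀
    have h1 : 0 ≤ qdf Ψ₁ _ 0 := hMLF.nonneg 0 _ hxB 0
    rwa [hx.qdf_eq_symStateForm, hx0] at h1
  have hobs : ∀ x, IsStateTrajectory A x → (∀ t, L.mulVec (x t) = 0) → x 0 = 0 := by
    intro x hx hLx
    have h1 : (fun t => K.mulVec (x t)) = 0 := by
      refine hMLF.deriv_definite 0 _ (hx.mem_kerD S.det_R₁ hX h) fun t => ?_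
      change deriv (qdf Ψ₁ _) t = 0
      have h0 : qdf Ψ₁ (fun τ => K.mulVec (x τ)) = fun τ => dotProduct (x τ) (P.mulVec (x τ)) :=
        funext fun τ => hx.qdf_eq_symStateForm Ψ₁ τ
      rw [h0, (hx.hasDerivAt_quadratic hL t).deriv, hLx]
      simp
    have h2 := hx.diffOp_eq (K := K) S.X₁ 0
    rw [stateCoeff_stateMap S.det_R₁ hX h, Matrix.one_mulVec] at h2
    rw [← h2, h1, diffOp_zero]
  obtain ⟨M, hM⟩ := StandardSLDS.exists_mul_R₂_eq h (toBlocks₂₁_eq_neg_mul hP hpos hmin)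
  refine ⟨M, ?_, ?_⟩
  · rw [IsSPRCompletion, ← ratMat_mul, ← hM]
    refine h.isStrictlyPositiveReal S.det_R₁ hP hL
      (fun z hz => aeval_charpoly_ne_zero_of_lyapunov hP hpos hL hobs hz) ?_
    rwa [← hLQ]
  · rw [← ratMat_mul, ← hM, ratMat_mul, Matrix.mul_assoc]
    exact hX.isStrictlyProper.const_mul _
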